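/- Let $\mathbb{C}[z^{\pm1}]$ be the ring of Laurent polynomials, $\mathbb{C}_\Delta[z^{\pm}]$ its localization along $\Delta=z-z^{-1}$, $\theta=z\partial_z$, and $s(f)(z)=f(z^{-1})$. A differential-reflection operator is a finite sum of operators $a\,\theta^i s^j$ with $a\in\mathbb{C}_\Delta[z^\pm]$, $i\ge 0$, $j\in\{0,1\}$. For $k=(k_1,k_2)\in\mathbb{C}^2$ the Cherednik operator of type $BC_1$ is $$D_k=\theta+\frac{k_1}{1-z^{-1}}(1-s)+\frac{2k_2}{1-z^{-2}}(1-s)-\tfrac12(k_1+2k_2).$$ For $\ell=(\ell_1,\ell_2)\in2\mathbb{Z}\times\mathbb{Z}$ let $\mathbb{S}_{\mathrm{ns}}(\ell,k)$ be the space of non-symmetric shift operators with shift $\ell$, i.e. of the differential-reflection operators $\mathcal S$ with $\mathcal S D_k=D_{k+\ell}\mathcal S$ and $\mathcal S(\mathbb{C}[z^{\pm1}])\subset\mathbb{C}[z^{\pm1}]$. Composition makes $\mathbb{S}_{\mathrm{ns}}(0,k)$ an algebra and $\mathbb{S}_{\mathrm{ns}}(\ell,k)$ a right $\mathbb{S}_{\mathrm{ns}}(0,k)$-module.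 Put $$\mathcal G_+(k)=\frac{1}{z-z^{-1}}\theta-\frac{z(1-s)}{(z-z^{-1})^2},\qquad \mathcal G_-(k)=(z-z^{-1})\theta+(k_1+2k_2-1)(z+z^{-1})+2k_1+z^{-1}-zs,$$ $$\mathcal E_+(k)=\frac{1+z^{-1}}{1-z^{-1}}\theta+k_2-\tfrac12-\frac{1+z^{-1}}{1-z^{-1}}\,\frac{1-s}{z-z^{-1}},\qquad \mathcal E_-(k)=\frac{1-z^{-1}}{1+z^{-1}}\theta+k_1+k_2-\tfrac12+\frac{1-z^{-1}}{1+z^{-1}}\,\frac{1-s}{z-z^{-1}}.$$ Write $\ell=\varepsilon_1N_1(2,-1)+\varepsilon_2N_2(0,1)$ with $N_1,N_2\ge0$ and $\varepsilon_1,\varepsilon_2\in\{\pm1\}$, and let $$\mathcal G(\ell,k)=\prod_{i=0}^{N_1-1}\mathcal E_{\varepsilon_1}\big(k+\varepsilon_1i(2,-1)+\varepsilon_2N_2(0,1)\big)\ \prod_{j=0}^{N_2-1}\mathcal G_{\varepsilon_2}\big(k+\varepsilon_2j(0,1)\big),$$ where in each product the factors with larger index stand to the left. **Theorem.** Let $k\in\mathbb{C}^2$.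 1. The algebra $\mathbb{S}_{\mathrm{ns}}(0,k)$ is generated by $D_k$. 2. Let $\ell\in2\mathbb{Z}\times\mathbb{Z}$. Then $\mathcal G(\ell,k)\in\mathbb{S}_{\mathrm{ns}}(\ell,k)$. Assume that $k$ is non-resonant for $\ell$ in the following sense: if $\ell_1+\ell_2<0$ then $k_1+k_2\notin\{\tfrac12,\tfrac32,\tfrac52,\dots\}$, and if $\ell_2<0$ then $k_2\notin\{\tfrac12,\tfrac32,\tfrac52,\dots\}$. Then the right $\mathbb{S}_{\mathrm{ns}}(0,k)$-module $\mathbb{S}_{\mathrm{ns}}(\ell,k)$ is free of rank one with basis $\mathcal G(\ell,k)$. (In particular this holds for all $\ell$ when $k$ is generic, namely $k_2,\,k_1+k_2\notin\tfrac12+\mathbb{Z}_{\ge0}$.) 3. If $\ell,\ell'\in2\mathbb{Z}\times\mathbb{Z}$ satisfy $\mathrm{sign}(\ell_1)=\mathrm{sign}(\ell_1')$ and $\mathrm{sign}(\tfrac12\ell_1+\ell_2)=\mathrm{sign}(\tfrac12\ell'_1+\ell'_2)$, then $$\mathcal G(\ell+\ell',k)=\mathcal G(\ell',k+\ell)\,\mathcal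 G(\ell,k)=\mathcal G(\ell,k+\ell')\,\mathcal G(\ell',k).$$ -/

import Mathlib

open scoped Polynomial

noncomputable section

namespace BCOne

/-! ### The ambient field `ℂ(z)`, the reflection and the Euler derivation -/

/-- The field of rational functions in the variable `z`. It contains `ℂ[z, z⁻¹]` and its
localization along `z - z⁻¹`. -/
abbrev RatZ : Type := RatFunc ℂ

/-- The coordinate `z`. -/
def z : RatZ := RatFunc.X

theorem z_ne_zero : z ≠ 0 := RatFunc.X_ne_zero

theorem z_inv_ne_C (c : ℂ) : z⁻¹ ≠ RatFunc.C c := by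
  intro h
  have h2 : z = RatFunc.C c⁻¹ := by rw [map_inv₀, ← h, inv_inv]
  have h3 : algebraMap ℂ[X] RatZ (Polynomial.X - Polynomial.C c⁻¹) = 0 := by
    rw [map_sub, RatFunc.algebraMap_X, RatFunc.algebraMap_C]
    exact sub_eq_zero.2 h2
  exact Polynomial.X_sub_C_ne_zero _ (RatFunc.algebraMap_injective ℂ (by rw [h3, map_zero]))

theorem transcendental_z_inv : Transcendental ℂ (z⁻¹ : RatZ) :=
  RatFunc.transcendental_of_ne_C _ (fun ⟨c, hc⟩ => z_inv_ne_C c hc)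

/-- The reflection `s`, acting by `s(f)(z) = f(z⁻¹)`. -/
def refl : RatZ →ₐ[ℂ] RatZ :=
  RatFunc.liftAlgHom (Polynomial.aeval (z⁻¹ : RatZ))
    (nonZeroDivisors_le_comap_nonZeroDivisors_of_injective _
      (transcendental_iff_injective.1 transcendental_z_inv))

theorem refl_z : refl z = z⁻¹ := by
  have h := RatFunc.liftAlgHom_apply_div (Polynomial.aeval (z⁻¹ : RatZ))
    (nonZeroDivisors_le_comap_nonZeroDivisors_of_injective _
      (transcendental_iff_injective.1 transcendental_z_inv)) Polynomial.X 1
  simpa [z, refl] using h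

instance : Algebra.FormallyEtale ℂ[X] RatZ :=
  Algebra.FormallyEtale.of_isLocalization (nonZeroDivisors ℂ[X])

/-- The derivation `z ∂_z` of `ℂ(z)`: the extension to the fraction field of the derivation of
`ℂ[z]` that sends `z` to `z`. -/
def euler : Derivation ℂ RatZ RatZ :=
  (((Polynomial.mkDerivation ℂ z).liftKaehlerDifferential.liftBaseChange RatZ).comp
    (KaehlerDifferential.tensorKaehlerEquivOfFormallyEtale ℂ ℂ[X] RatZ).symm.toLinearMap).compDer
    (KaehlerDifferential.D ℂ RatZ)

theorem euler_z : euler z = z := by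
  have h := KaehlerDifferential.tensorKaehlerEquivOfFormallyEtale_symm_D_algebraMap
    ℂ ℂ[X] RatZ Polynomial.X
  rw [RatFunc.algebraMap_X] at h
  simp [euler, z, h]

/-! ### Differential-reflection operators -/

/-- The `ℂ`-linear operators on `ℂ(z)`. -/
abbrev Op : Type := Module.End ℂ RatZ

/-- Multiplication by `f`. -/
def mulOp (f : RatZ) : Op := Algebra.lmul ℂ RatZ f

/-- The operator `θ = z ∂_z`. -/
def theta : Op := (euler : RatZ →ₗ[ℂ] RatZ)

/-- The operator `s`. -/
def s : Op := refl.toLinearMap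

/-- The ring `ℂ[z, z⁻¹]` of Laurent polynomials. -/
def laurent : Subalgebra ℂ RatZ := Algebra.adjoin ℂ {z, z⁻¹}

/-- The localization of `ℂ[z, z⁻¹]` along `z - z⁻¹`. -/
def laurentLoc : Subalgebra ℂ RatZ := Algebra.adjoin ℂ {z, z⁻¹, (z - z⁻¹)⁻¹}

/-- The algebra of differential-reflection operators with coefficients in `laurentLoc`: the
operators that are generated by the multiplications with elements of `laurentLoc`, `z ∂_z`, and
`s`. By the commutation rules `θ a = a θ + θ(a)`, `s a = s(a) s`, `s θ = -θ s`, its elements are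
the sums of operators `a θ ^ i s ^ j` with `a` in `laurentLoc`. -/
def diffRefl : Subalgebra ℂ Op :=
  Algebra.adjoin ℂ (mulOp '' (laurentLoc : Set RatZ) ∪ {theta, s})

/-! ### Multiplicities and the Cherednik operator -/

/-- The multiplicity `k + ℓ`. -/
def shift (k : ℂ × ℂ) (l : ℤ × ℤ) : ℂ × ℂ := (k.1 + l.1, k.2 + l.2)

theorem shift_zero (k : ℂ × ℂ) : shift k 0 = k := by simp [shift]

/-- `ρ(k) = (k₁ + 2 k₂) / 2`. -/
def rho (k : ℂ × ℂ) : ℂ := (k.1 + 2 * k.2) / 2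

/-- The Cherednik operator `D_k`. -/
def cherednik (k : ℂ × ℂ) : Op :=
  theta + k.1 • (mulOp (1 / (1 - z⁻¹)) * (1 - s))
    + (2 * k.2) • (mulOp (1 / (1 - z⁻¹ ^ 2)) * (1 - s)) - rho k • 1

/-! ### Non-symmetric shift operators -/

/-- The space of non-symmetric shift operators with shift `ℓ`: the differential-reflection
operators `S` with `S D_k = D_{k + ℓ} S` that map Laurent polynomials to Laurent polynomials. -/
def shiftOps (l : ℤ × ℤ) (k : ℂ × ℂ) : Submodule ℂ Op where
  carrier := {S | S ∈ diffRefl ∧ S * cherednik k = cherednik (shift k l) * S ∧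
    ∀ f ∈ laurent, S f ∈ laurent}
  zero_mem' := ⟨zero_mem _, by simp, fun f _ => zero_mem laurent⟩
  add_mem' := by
    rintro S T ⟨hS, hS', hS''⟩ ⟨hT, hT', hT''⟩
    exact ⟨add_mem hS hT, by rw [add_mul, mul_add, hS', hT'],
      fun f hf => add_mem (hS'' f hf) (hT'' f hf)⟩
  smul_mem' := by
    rintro c S ⟨hS, hS', hS''⟩
    exact ⟨Subalgebra.smul_mem _ hS c, by rw [smul_mul_assoc, mul_smul_comm, hS'],
      fun f hf => Subalgebra.smul_mem _ (hS'' f hf) c⟩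

theorem mul_mem_shiftOps {l l' : ℤ × ℤ} {k : ℂ × ℂ} {S T : Op}
    (hT : T ∈ shiftOps l' (shift k l)) (hS : S ∈ shiftOps l k) :
    T * S ∈ shiftOps (l + l') k := by
  obtain ⟨hS, hS', hS''⟩ := hS
  obtain ⟨hT, hT', hT''⟩ := hT
  refine ⟨mul_mem hT hS, ?_, fun f hf => hT'' _ (hS'' f hf)⟩
  have h : shift (shift k l) l' = shift k (l + l') := by
    simp [shift, add_assoc]
  rw [mul_assoc, hS', ← mul_assoc, hT', h, mul_assoc]

/-- The algebra of non-symmetric shift operators with shift zero. -/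
def shiftAlg (k : ℂ × ℂ) : Subalgebra ℂ Op where
  carrier := shiftOps 0 k
  zero_mem' := zero_mem _
  add_mem' := add_mem
  mul_mem' := by
    intro S T hS hT
    have hS' : S ∈ shiftOps 0 (shift k 0) := by rw [shift_zero]; exact hS
    have h := mul_mem_shiftOps hS' hT
    rwa [add_zero] at h
  algebraMap_mem' := fun c => by
    refine ⟨algebraMap_mem _ c, ?_, fun f hf => ?_⟩
    · rw [shift_zero]
      exact Algebra.commutes c (cherednik k)
    · rw [Module.algebraMap_end_apply]
      exact Subalgebra.smul_mem _ hf c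

theorem mul_mem_shiftOps_right {l : ℤ × ℤ} {k : ℂ × ℂ} {S Q : Op}
    (hS : S ∈ shiftOps l k) (hQ : Q ∈ shiftAlg k) : S * Q ∈ shiftOps l k := by
  have hS' : S ∈ shiftOps l (shift k 0) := by rw [shift_zero]; exact hS
  have h := mul_mem_shiftOps hS' hQ
  rwa [zero_add] at h

/-- The right module structure `S ↦ S Q` of the shift operators with shift `ℓ` over the algebra
of shift operators with shift zero. -/
instance shiftOpsModule (l : ℤ × ℤ) (k : ℂ × ℂ) :
    Module (shiftAlg k)ᵐᵒᵖ (shiftOps l k) where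
  smul Q S := ⟨(S : Op) * (Q.unop : Op), mul_mem_shiftOps_right S.2 Q.unop.2⟩
  one_smul S := Subtype.ext (mul_one (S : Op))
  mul_smul Q R S := Subtype.ext (mul_assoc (S : Op) (R.unop : Op) (Q.unop : Op)).symm
  smul_zero Q := Subtype.ext (zero_mul (Q.unop : Op))
  smul_add Q S T := Subtype.ext (add_mul (S : Op) (T : Op) (Q.unop : Op))
  add_smul Q R S := Subtype.ext (mul_add (S : Op) (Q.unop : Op) (R.unop : Op))
  zero_smul S := Subtype.ext (mul_zero (S : Op))

theorem coe_op_smul (l : ℤ × ℤ) (k : ℂ × ℂ) (Q : (shiftAlg k)ᵐᵒᵖ) (S : shiftOps l k) :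
    ((Q • S : shiftOps l k) : Op) = (S : Op) * (Q.unop : Op) := rfl

/-! ### The fundamental shift operators and the generators -/

/-- The non-symmetric forward shift operator, with shift `(0, 1)`. -/
def forward (_k : ℂ × ℂ) : Op :=
  mulOp (1 / (z - z⁻¹)) * theta - mulOp (z / (z - z⁻¹) ^ 2) * (1 - s)

/-- The non-symmetric backward shift operator, with shift `(0, -1)`. -/
def backward (k : ℂ × ℂ) : Op :=
  mulOp (z - z⁻¹) * theta + (k.1 + 2 * k.2 - 1) • mulOp (z + z⁻¹) + (2 * k.1) • 1
    + mulOp z⁻¹ - mulOp z * s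

/-- The non-symmetric contiguity shift operator with shift `(2, -1)`. -/
def contigPlus (k : ℂ × ℂ) : Op :=
  mulOp ((1 + z⁻¹) / (1 - z⁻¹)) * theta + (k.2 - 1 / 2) • 1
    - mulOp ((1 + z⁻¹) / (1 - z⁻¹) * (1 / (z - z⁻¹))) * (1 - s)

/-- The non-symmetric contiguity shift operator with shift `(-2, 1)`. -/
def contigMinus (k : ℂ × ℂ) : Op :=
  mulOp ((1 - z⁻¹) / (1 + z⁻¹)) * theta + (k.1 + k.2 - 1 / 2) • 1
    + mulOp ((1 - z⁻¹) / (1 + z⁻¹) * (1 / (z - z⁻¹))) * (1 - s)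

/-- The composition `F(k + (N - 1) v) ⋯ F(k + v) F(k)`. -/
def chain (F : ℂ × ℂ → Op) (v : ℤ × ℤ) : ℕ → ℂ × ℂ → Op
  | 0, _ => 1
  | N + 1, k => F (shift k ((N : ℤ) • v)) * chain F v N k

/-- For `n = ± N`, the composition of `N` forward (backward) shift operators, with
shift `n (0, 1)`. -/
def forwardPow (n : ℤ) (k : ℂ × ℂ) : Op :=
  if 0 ≤ n then chain forward (0, 1) n.natAbs k else chain backward (0, -1) n.natAbs k

/-- For `m = ± N`, the composition of `N` contiguity shift operators, with shift `m (2, -1)`. -/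
def contigPow (m : ℤ) (k : ℂ × ℂ) : Op :=
  if 0 ≤ m then chain contigPlus (2, -1) m.natAbs k else chain contigMinus (-2, 1) m.natAbs k

/-- The operator `𝒢(ℓ, k)` for `ℓ = m (2, -1) + n (0, 1)`, that is, `m = ℓ₁ / 2` and
`n = ℓ₁ / 2 + ℓ₂`, where `ℓ₁` is even: first `n` forward (backward) shifts from `k` to
`k + n (0, 1)`, then `m` contiguity shifts from there to `k + ℓ`. -/
def gen (l : ℤ × ℤ) (k : ℂ × ℂ) : Op :=
  contigPow (l.1 / 2) (shift k (0, l.1 / 2 + l.2)) * forwardPow (l.1 / 2 + l.2) k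

end BCOne

end

/-!
The operators are studied in the coordinate `t = (z - 1) / (z + 1)`, which is odd for the reflection
and satisfies `θ t = (1 - t²) / 2`; the coordinate `t⁻¹` has the same two properties, and the two
vanish at the fixed points `z = 1` and `z = -1` of the reflection. In both coordinates the Cherednik
operator is, up to the factor `1 / 2` and less singular terms, a rank one Dunkl operator, with the
parameter `k₁ + k₂` at `z = 1` and `k₂` at `z = -1` (`cherednik_apply_coord`).

A differential-reflection operator has a unique normal form `∑ aᵢ Eⁱ + ∑ bᵢ Eⁱ s` with `E = t ∂_t`
(`exists_opOf₂_eq`, `eq_zero_of_opOf₂_eq_zero`). It acts on `t ^ j` by the scalar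
`∑ aᵢ jⁱ + (-1) ^ j ∑ bᵢ jⁱ`, so that identities between such operators become identities between
polynomials in `j`.

*Upper bound.* If `S D_k = D_{k + ℓ} S` and `S` has order `N`, then the highest coefficient `b_N`
vanishes, and `a_N` solves a first-order linear differential equation that depends only on `N`, `k`
and `ℓ` (`symbol_of_intertwine`). Two shift operators of the same order and shift therefore have
proportional symbols. Given a shift operator `G` of the smallest possible order, a multiple of
`G D_k ^ j` can be subtracted from any other one to lower its order, and by induction every shift
operator is `G q(D_k)` with a polynomial `q` (`exists_eq_mul_aeval`). For `ℓ = 0` and `G = 1`, this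
is the statement about the algebra.

*Lower bound.* The operator `gen ℓ k` has the order `max |ℓ₁ + ℓ₂| |ℓ₂|`, as it is a product of this
many first-order operators. A nonzero shift operator cannot have a smaller order, and this is a
local statement at `z = ± 1` (`natAbs_le_order`): the leading coefficients `c j` of the functions
`S (w ^ j)`, where `w` is the local coordinate, are polynomials in `j` for each parity of `j`, of
degree at most the order `N` of `S`, and they satisfy the recursion for an operator that intertwines
two Dunkl operators whose parameters differ by `n = ℓ₁ + ℓ₂` or `n = ℓ₂` (`leading_recursion`). The
recursion determines the degree `M` of these polynomials in terms of `n` and of the degree of `S` as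
a graded operator (`natDegree_of_recursion`). If `M < |n|`, then too many of the `c j` are zero: for
`n > 0` because `S` preserves the Laurent polynomials and hence creates no poles, and for `n < 0`
because the nonresonance of `k` forces the recursion to start with zeros.

The generator itself is a shift operator, and its composition rules hold, because of direct
computations with the four elementary operators: they intertwine the Cherednik operators, they
commute with each other in the appropriate sense, and they preserve the Laurent polynomials.
Finally, products of first-order operators can be cancelled on the left
(`IsFirstOrderProduct.eq_zero_of_mul_eq_zero`), which makes the module free.
-/

noncomputable section

namespace BCOne

/-! ### Calculus in `ℂ(z)` -/

theorem algebraMap_eq_aeval_z (p : ℂ[X]) : algebraMap ℂ[X] RatZ p = Polynomial.aeval z p := by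
  induction p using Polynomial.induction_on' with
  | add p q hp hq => rw [map_add, map_add, hp, hq]
  | monomial n c =>
    rw [← Polynomial.C_mul_X_pow_eq_monomial, map_mul, map_pow, RatFunc.algebraMap_X,
      RatFunc.algebraMap_C, map_mul, map_pow, Polynomial.aeval_X, Polynomial.aeval_C]
    rfl

theorem aeval_z_ne_zero {p : ℂ[X]} (hp : p ≠ 0) : Polynomial.aeval (z : RatZ) p ≠ 0 := by
  rw [← algebraMap_eq_aeval_z]
  exact RatFunc.algebraMap_ne_zero hp

theorem exists_eq_aeval_div (f : RatZ) :
    ∃ p q : ℂ[X], q ≠ 0 ∧ IsCoprime p q ∧ f = Polynomial.aeval z p / Polynomial.aeval z q :=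
  ⟨f.num, f.denom, f.denom_ne_zero, f.isCoprime_num_denom, by
    rw [← algebraMap_eq_aeval_z, ← algebraMap_eq_aeval_z, RatFunc.num_div_denom]⟩

theorem euler_aeval (x : RatZ) (p : ℂ[X]) :
    euler (Polynomial.aeval x p) = Polynomial.aeval x (Polynomial.derivative p) * euler x := by
  rw [Derivation.map_aeval, smul_eq_mul]

theorem refl_aeval (x : RatZ) (p : ℂ[X]) :
    refl (Polynomial.aeval x p) = Polynomial.aeval (refl x) p :=
  (Polynomial.aeval_algHom_apply refl x p).symm

theorem euler_C (c : ℂ) : euler (algebraMap ℂ RatZ c) = 0 := Derivation.map_algebraMap _ _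

theorem refl_C (c : ℂ) : refl (algebraMap ℂ RatZ c) = algebraMap ℂ RatZ c := refl.commutes c

theorem euler_mul (a b : RatZ) : euler (a * b) = a * euler b + b * euler a := by
  simp [Derivation.leibniz]

theorem euler_inv (a : RatZ) : euler a⁻¹ = -a⁻¹ ^ 2 * euler a := by
  simp [Derivation.leibniz_inv]

theorem euler_div (a b : RatZ) : euler (a / b) = b⁻¹ ^ 2 * (b * euler a - a * euler b) := by
  simp [Derivation.leibniz_div]

theorem euler_pow (a : RatZ) (n : ℕ) : euler (a ^ n) = n * a ^ (n - 1) * euler a := by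
  simp [Derivation.leibniz_pow, mul_assoc]

theorem refl_refl (f : RatZ) : refl (refl f) = f := by
  obtain ⟨p, q, -, -, rfl⟩ := exists_eq_aeval_div f
  simp only [map_div₀, refl_aeval, refl_z, map_inv₀, inv_inv]

theorem euler_refl (f : RatZ) : euler (refl f) = -refl (euler f) := by
  obtain ⟨p, q, -, -, rfl⟩ := exists_eq_aeval_div f
  simp only [map_div₀, refl_aeval, refl_z, euler_div, euler_aeval, euler_inv, euler_z, map_mul,
    map_sub, map_pow, map_inv₀]
  have := z_ne_zero
  field_simp
  ring

/-- The Euler derivation has only the constants in its kernel: if `p / q` is in lowest terms and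
killed, then `q` divides its own derivative. -/
theorem eq_C_of_euler_eq_zero {f : RatZ} (hf : euler f = 0) : ∃ c : ℂ, f = algebraMap ℂ RatZ c := by
  obtain ⟨p, q, hq, hpq, rfl⟩ := exists_eq_aeval_div f
  have hq' := aeval_z_ne_zero hq
  rw [euler_div, euler_aeval, euler_aeval, euler_z] at hf
  have h1 : Polynomial.aeval z (q * Polynomial.derivative p - p * Polynomial.derivative q) = 0 := by
    rw [map_sub, map_mul, map_mul]
    have h := (mul_eq_zero.1 hf).resolve_left (pow_ne_zero 2 (inv_ne_zero hq'))
    refine (mul_eq_zero.1 ?_).resolve_left z_ne_zero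
    linear_combination h
  have h2 : q * Polynomial.derivative p - p * Polynomial.derivative q = 0 := by
    by_contra h
    exact aeval_z_ne_zero h h1
  have h3 : q ∣ Polynomial.derivative q :=
    hpq.symm.dvd_of_dvd_mul_left ⟨Polynomial.derivative p, by linear_combination -h2⟩
  have h4 : Polynomial.derivative q = 0 := by
    by_contra h
    exact absurd (Polynomial.degree_derivative_lt hq) (not_lt.2 (Polynomial.degree_le_of_dvd h3 h))
  have h5 : Polynomial.derivative p = 0 := by
    rw [h4, mul_zero, sub_zero] at h2
    exact (mul_eq_zero.1 h2).resolve_left hq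
  rw [Polynomial.eq_C_of_derivative_eq_zero h4, Polynomial.eq_C_of_derivative_eq_zero h5]
  exact ⟨p.coeff 0 / q.coeff 0, by simp⟩

theorem z_ne_C (c : ℂ) : z ≠ algebraMap ℂ RatZ c := fun h => z_inv_ne_C c⁻¹ (by
  rw [h, ← map_inv₀]; rfl)

theorem z_sub_one_ne_zero : z - 1 ≠ 0 := fun h => z_ne_C 1 (by rw [map_one]; exact sub_eq_zero.1 h)

theorem z_add_one_ne_zero : z + 1 ≠ 0 := fun h => z_ne_C (-1) (by
  rw [map_neg, map_one]; exact eq_neg_of_add_eq_zero_left h)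

theorem one_sub_z_inv : 1 - z⁻¹ = (z - 1) / z := by
  have := z_ne_zero
  field_simp

theorem one_add_z_inv : 1 + z⁻¹ = (z + 1) / z := by
  have := z_ne_zero
  field_simp

theorem one_sub_z_inv_sq : 1 - z⁻¹ ^ 2 = (z - 1) * (z + 1) / z ^ 2 := by
  have := z_ne_zero
  field_simp
  ring

theorem z_sub_z_inv : z - z⁻¹ = (z - 1) * (z + 1) / z := by
  have := z_ne_zero
  field_simp
  ring

/-! ### The action of the operators on a rational function -/

theorem mulOp_apply (a f : RatZ) : mulOp a f = a * f := rfl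

theorem theta_apply (f : RatZ) : theta f = euler f := rfl

theorem s_apply (f : RatZ) : s f = refl f := rfl

theorem cherednik_apply (k : ℂ × ℂ) (f : RatZ) :
    cherednik k f = euler f + algebraMap ℂ RatZ k.1 * (z / (z - 1) * (f - refl f))
      + algebraMap ℂ RatZ (2 * k.2) * (z ^ 2 / ((z - 1) * (z + 1)) * (f - refl f))
      - algebraMap ℂ RatZ (rho k) * f := by
  simp only [cherednik, mulOp_apply, theta_apply, s_apply, one_sub_z_inv_sq, one_sub_z_inv,
    LinearMap.sub_apply, LinearMap.add_apply, Module.End.mul_apply, LinearMap.smul_apply,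
    Module.End.one_apply, Algebra.smul_def (A := RatZ), one_div_div]

theorem forward_apply (k : ℂ × ℂ) (f : RatZ) :
    forward k f = z / ((z - 1) * (z + 1)) * euler f
      - z ^ 3 / ((z - 1) * (z + 1)) ^ 2 * (f - refl f) := by
  have := z_ne_zero
  have := z_sub_one_ne_zero
  have := z_add_one_ne_zero
  simp only [forward, z_sub_z_inv, LinearMap.sub_apply, Module.End.mul_apply, mulOp_apply,
    theta_apply, s_apply, Module.End.one_apply]
  field_simp

theorem backward_apply (k : ℂ × ℂ) (f : RatZ) :
    backward k f = (z - 1) * (z + 1) / z * euler f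
      + (algebraMap ℂ RatZ (k.1 + 2 * k.2 - 1) * (z + 1 / z) + algebraMap ℂ RatZ (2 * k.1)
        + 1 / z) * f - z * refl f := by
  simp only [backward, mulOp_apply, theta_apply, s_apply, z_sub_z_inv,
    LinearMap.sub_apply, LinearMap.add_apply, Module.End.mul_apply, LinearMap.smul_apply,
    Module.End.one_apply, Algebra.smul_def (A := RatZ)]
  ring

theorem contigPlus_apply (k : ℂ × ℂ) (f : RatZ) :
    contigPlus k f = (z + 1) / (z - 1) * euler f + algebraMap ℂ RatZ (k.2 - 1 / 2) * f
      - z / (z - 1) ^ 2 * (f - refl f) := by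
  have := z_ne_zero
  have := z_sub_one_ne_zero
  have := z_add_one_ne_zero
  simp only [contigPlus, z_sub_z_inv, one_sub_z_inv, one_add_z_inv, LinearMap.sub_apply,
    LinearMap.add_apply, Module.End.mul_apply, mulOp_apply,
    theta_apply, s_apply, Module.End.one_apply, LinearMap.smul_apply,
    Algebra.smul_def (A := RatZ)]
  field_simp

theorem contigMinus_apply (k : ℂ × ℂ) (f : RatZ) :
    contigMinus k f = (z - 1) / (z + 1) * euler f + algebraMap ℂ RatZ (k.1 + k.2 - 1 / 2) * f
      + z / (z + 1) ^ 2 * (f - refl f) := by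
  have := z_ne_zero
  have := z_sub_one_ne_zero
  have := z_add_one_ne_zero
  simp only [contigMinus, z_sub_z_inv, one_sub_z_inv, one_add_z_inv, LinearMap.sub_apply,
    LinearMap.add_apply, Module.End.mul_apply, mulOp_apply,
    theta_apply, s_apply, Module.End.one_apply, LinearMap.smul_apply,
    Algebra.smul_def (A := RatZ)]
  field_simp

/-! ### Intertwining and commutation relations of the elementary shift operators -/

/- The identities are checked on an arbitrary rational function `f`. Both sides are combinations of
`f`, `θ f`, `θ θ f` and their reflections, and the coefficients are compared in `ℂ(z)`. -/

section Identities

set_option linter.unusedSimpArgs false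

theorem euler_two : euler (2 : RatZ) = 0 := by
  rw [← map_ofNat (algebraMap ℂ RatZ) 2]
  exact euler_C 2

theorem z_inv_sub_one : z⁻¹ - 1 = -(z - 1) / z := by
  have := z_ne_zero
  field_simp
  ring

theorem z_inv_add_one : z⁻¹ + 1 = (z + 1) / z := by
  have := z_ne_zero
  field_simp
  ring

theorem forward_mul_cherednik (k : ℂ × ℂ) :
    forward k * cherednik k = cherednik (shift k (0, 1)) * forward k := by
  ext f
  have h0 := z_ne_zero
  have h1 := z_sub_one_ne_zero
  have h2 := z_add_one_ne_zero
  simp only [Module.End.mul_apply, cherednik_apply, forward_apply, map_add, map_sub, map_mul,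
    map_div₀, map_pow, map_one, map_ofNat, euler_mul, euler_div, euler_z, euler_C, refl_C, refl_z,
    refl_refl, euler_refl, euler_pow, Derivation.map_one_eq_zero, shift, rho, Int.cast_zero,
    Int.cast_one, map_zero, Int.cast_neg, map_neg, Int.cast_ofNat, z_inv_sub_one, z_inv_add_one,
    euler_two]
  generalize euler (euler f) = f2
  generalize refl (euler f) = g1
  generalize euler f = f1
  generalize refl f = g
  generalize algebraMap ℂ RatZ k.1 = a
  generalize algebraMap ℂ RatZ k.2 = b
  generalize z = x at *
  field_simp
  ring

theorem backward_mul_cherednik (k : ℂ × ℂ) :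
    backward k * cherednik k = cherednik (shift k (0, -1)) * backward k := by
  ext f
  have h0 := z_ne_zero
  have h1 := z_sub_one_ne_zero
  have h2 := z_add_one_ne_zero
  simp only [Module.End.mul_apply, cherednik_apply, backward_apply, map_add, map_sub, map_mul,
    map_div₀, map_pow, map_one, map_ofNat, euler_mul, euler_div, euler_z, euler_C, refl_C, refl_z,
    refl_refl, euler_refl, euler_pow, Derivation.map_one_eq_zero, shift, rho, Int.cast_zero,
    Int.cast_one, map_zero, Int.cast_neg, map_neg, Int.cast_ofNat, z_inv_sub_one, z_inv_add_one,
    euler_two]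
  generalize euler (euler f) = f2
  generalize refl (euler f) = g1
  generalize euler f = f1
  generalize refl f = g
  generalize algebraMap ℂ RatZ k.1 = a
  generalize algebraMap ℂ RatZ k.2 = b
  generalize z = x at *
  field_simp
  ring

theorem contigPlus_mul_cherednik (k : ℂ × ℂ) :
    contigPlus k * cherednik k = cherednik (shift k (2, -1)) * contigPlus k := by
  ext f
  have h0 := z_ne_zero
  have h1 := z_sub_one_ne_zero
  have h2 := z_add_one_ne_zero
  simp only [Module.End.mul_apply, cherednik_apply, contigPlus_apply, map_add, map_sub, map_mul,
    map_div₀, map_pow, map_one, map_ofNat, euler_mul, euler_div, euler_z, euler_C, refl_C, refl_z,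
    refl_refl, euler_refl, euler_pow, Derivation.map_one_eq_zero, shift, rho, Int.cast_zero,
    Int.cast_one, map_zero, Int.cast_neg, map_neg, Int.cast_ofNat, z_inv_sub_one, z_inv_add_one,
    euler_two]
  generalize euler (euler f) = f2
  generalize refl (euler f) = g1
  generalize euler f = f1
  generalize refl f = g
  generalize algebraMap ℂ RatZ k.1 = a
  generalize algebraMap ℂ RatZ k.2 = b
  generalize z = x at *
  field_simp
  ring

theorem contigMinus_mul_cherednik (k : ℂ × ℂ) :
    contigMinus k * cherednik k = cherednik (shift k (-2, 1)) * contigMinus k := by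
  ext f
  have h0 := z_ne_zero
  have h1 := z_sub_one_ne_zero
  have h2 := z_add_one_ne_zero
  simp only [Module.End.mul_apply, cherednik_apply, contigMinus_apply, map_add, map_sub, map_mul,
    map_div₀, map_pow, map_one, map_ofNat, euler_mul, euler_div, euler_z, euler_C, refl_C, refl_z,
    refl_refl, euler_refl, euler_pow, Derivation.map_one_eq_zero, shift, rho, Int.cast_zero,
    Int.cast_one, map_zero, Int.cast_neg, map_neg, Int.cast_ofNat, z_inv_sub_one, z_inv_add_one,
    euler_two]
  generalize euler (euler f) = f2
  generalize refl (euler f) = g1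
  generalize euler f = f1
  generalize refl f = g
  generalize algebraMap ℂ RatZ k.1 = a
  generalize algebraMap ℂ RatZ k.2 = b
  generalize z = x at *
  field_simp
  ring

theorem forward_mul_contigPlus (k : ℂ × ℂ) :
    forward (shift k (2, -1)) * contigPlus k = contigPlus (shift k (0, 1)) * forward k := by
  ext f
  have h0 := z_ne_zero
  have h1 := z_sub_one_ne_zero
  have h2 := z_add_one_ne_zero
  simp only [Module.End.mul_apply, forward_apply, contigPlus_apply, map_add, map_sub, map_mul,
    map_div₀, map_pow, map_one, map_ofNat, euler_mul, euler_div, euler_z, euler_C, refl_C, refl_z,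
    refl_refl, euler_refl, euler_pow, Derivation.map_one_eq_zero, shift, rho, Int.cast_zero,
    Int.cast_one, map_zero, Int.cast_neg, map_neg, Int.cast_ofNat, z_inv_sub_one, z_inv_add_one,
    euler_two]
  generalize euler (euler f) = f2
  generalize refl (euler f) = g1
  generalize euler f = f1
  generalize refl f = g
  generalize algebraMap ℂ RatZ k.1 = a
  generalize algebraMap ℂ RatZ k.2 = b
  generalize z = x at *
  field_simp
  ring

theorem forward_mul_contigMinus (k : ℂ × ℂ) :
    forward (shift k (-2, 1)) * contigMinus k = contigMinus (shift k (0, 1)) * forward k := by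
  ext f
  have h0 := z_ne_zero
  have h1 := z_sub_one_ne_zero
  have h2 := z_add_one_ne_zero
  simp only [Module.End.mul_apply, forward_apply, contigMinus_apply, map_add, map_sub, map_mul,
    map_div₀, map_pow, map_one, map_ofNat, euler_mul, euler_div, euler_z, euler_C, refl_C, refl_z,
    refl_refl, euler_refl, euler_pow, Derivation.map_one_eq_zero, shift, rho, Int.cast_zero,
    Int.cast_one, map_zero, Int.cast_neg, map_neg, Int.cast_ofNat, z_inv_sub_one, z_inv_add_one,
    euler_two]
  generalize euler (euler f) = f2
  generalize refl (euler f) = g1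
  generalize euler f = f1
  generalize refl f = g
  generalize algebraMap ℂ RatZ k.1 = a
  generalize algebraMap ℂ RatZ k.2 = b
  generalize z = x at *
  field_simp
  ring

theorem backward_mul_contigPlus (k : ℂ × ℂ) :
    backward (shift k (2, -1)) * contigPlus k = contigPlus (shift k (0, -1)) * backward k := by
  ext f
  have h0 := z_ne_zero
  have h1 := z_sub_one_ne_zero
  have h2 := z_add_one_ne_zero
  simp only [Module.End.mul_apply, backward_apply, contigPlus_apply, map_add, map_sub, map_mul,
    map_div₀, map_pow, map_one, map_ofNat, euler_mul, euler_div, euler_z, euler_C, refl_C, refl_z,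
    refl_refl, euler_refl, euler_pow, Derivation.map_one_eq_zero, shift, rho, Int.cast_zero,
    Int.cast_one, map_zero, Int.cast_neg, map_neg, Int.cast_ofNat, z_inv_sub_one, z_inv_add_one,
    euler_two]
  generalize euler (euler f) = f2
  generalize refl (euler f) = g1
  generalize euler f = f1
  generalize refl f = g
  generalize algebraMap ℂ RatZ k.1 = a
  generalize algebraMap ℂ RatZ k.2 = b
  generalize z = x at *
  field_simp
  ring

theorem backward_mul_contigMinus (k : ℂ × ℂ) :
    backward (shift k (-2, 1)) * contigMinus k = contigMinus (shift k (0, -1)) * backward k := by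
  ext f
  have h0 := z_ne_zero
  have h1 := z_sub_one_ne_zero
  have h2 := z_add_one_ne_zero
  simp only [Module.End.mul_apply, backward_apply, contigMinus_apply, map_add, map_sub, map_mul,
    map_div₀, map_pow, map_one, map_ofNat, euler_mul, euler_div, euler_z, euler_C, refl_C, refl_z,
    refl_refl, euler_refl, euler_pow, Derivation.map_one_eq_zero, shift, rho, Int.cast_zero,
    Int.cast_one, map_zero, Int.cast_neg, map_neg, Int.cast_ofNat, z_inv_sub_one, z_inv_add_one,
    euler_two]
  generalize euler (euler f) = f2
  generalize refl (euler f) = g1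
  generalize euler f = f1
  generalize refl f = g
  generalize algebraMap ℂ RatZ k.1 = a
  generalize algebraMap ℂ RatZ k.2 = b
  generalize z = x at *
  field_simp
  ring

end Identities

/-! ### The elementary operators are shift operators -/

theorem z_mem_laurent : z ∈ laurent := Algebra.subset_adjoin (by simp)

theorem z_inv_mem_laurent : z⁻¹ ∈ laurent := Algebra.subset_adjoin (by simp)

theorem C_mem_laurent (c : ℂ) : algebraMap ℂ RatZ c ∈ laurent := laurent.algebraMap_mem c

theorem laurent_le_laurentLoc : laurent ≤ laurentLoc :=
  Algebra.adjoin_mono (by intro x; simp; tauto)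

theorem disc_inv_mem_laurentLoc : (z - z⁻¹)⁻¹ ∈ laurentLoc := Algebra.subset_adjoin (by simp)

theorem euler_one : euler 1 = 0 := Derivation.map_one_eq_zero _

/-- A subspace that contains `1` and is stable under left multiplication with the generators of an
algebra contains the algebra. -/
theorem adjoin_mem_of_mul_mem {A : Type*} [Ring A] [Algebra ℂ A] {S : Set A} (M : Submodule ℂ A)
    (one : 1 ∈ M) (mul : ∀ x ∈ S, ∀ y ∈ M, x * y ∈ M) {a : A} (ha : a ∈ Algebra.adjoin ℂ S) :
    a ∈ M := by
  suffices h : ∀ y ∈ M, a * y ∈ M by simpa using h 1 one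
  induction ha using Algebra.adjoin_induction with
  | mem x hx => exact mul x hx
  | algebraMap r =>
    intro y hy
    rw [← Algebra.smul_def]
    exact M.smul_mem r hy
  | add x x' _ _ hx hx' =>
    intro y hy
    rw [add_mul]
    exact M.add_mem (hx y hy) (hx' y hy)
  | mul x x' _ _ hx hx' =>
    intro y hy
    rw [mul_assoc]
    exact hx _ (hx' y hy)

/-- Every Laurent polynomial is `p(z + z⁻¹) + z q(z + z⁻¹)`: the Laurent polynomials are a free
module with basis `1, z` over the symmetric ones. -/
theorem exists_symmetric_decomposition {f : RatZ} (hf : f ∈ laurent) :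
    ∃ p q : ℂ[X], f = Polynomial.aeval (z + z⁻¹) p + z * Polynomial.aeval (z + z⁻¹) q := by
  have h0 := z_ne_zero
  let M : Submodule ℂ RatZ :=
    { carrier := {f | ∃ p q : ℂ[X],
        f = Polynomial.aeval (z + z⁻¹) p + z * Polynomial.aeval (z + z⁻¹) q}
      zero_mem' := ⟨0, 0, by simp⟩
      add_mem' := by
        rintro _ _ ⟨p, q, rfl⟩ ⟨p', q', rfl⟩
        exact ⟨p + p', q + q', by simp only [map_add]; ring⟩
      smul_mem' := by
        rintro c _ ⟨p, q, rfl⟩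
        exact ⟨c • p, c • q, by simp only [map_smul, smul_add, mul_smul_comm]⟩ }
  refine adjoin_mem_of_mul_mem M ⟨1, 0, by simp⟩ ?_ hf
  rintro x hx _ ⟨p, q, rfl⟩
  rcases hx with rfl | rfl
  · refine ⟨-q, p + Polynomial.X * q, ?_⟩
    simp only [map_add, map_neg, map_mul, Polynomial.aeval_X]
    field_simp
    ring
  · refine ⟨Polynomial.X * p + q, -p, ?_⟩
    simp only [map_add, map_neg, map_mul, Polynomial.aeval_X]
    field_simp
    ring

/-- An operator `T` with `T (h f) = a θ(h) f + h T f` for symmetric `h` preserves the Laurent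
polynomials as soon as `a (z - z⁻¹)`, `T 1` and `T z` are Laurent polynomials. -/
theorem map_laurent_of_twisted_leibniz {T : Op} {a : RatZ}
    (hT : ∀ h f, refl h = h → T (h * f) = a * euler h * f + h * T f)
    (ha : a * (z - z⁻¹) ∈ laurent) (h1 : T 1 ∈ laurent) (hz : T z ∈ laurent) :
    ∀ f ∈ laurent, T f ∈ laurent := by
  have hx : z + z⁻¹ ∈ laurent := add_mem z_mem_laurent z_inv_mem_laurent
  have hp : ∀ p : ℂ[X], Polynomial.aeval (z + z⁻¹) p ∈ laurent := fun p =>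
    Algebra.adjoin_le (Set.singleton_subset_iff.2 hx) (Polynomial.aeval_mem_adjoin_singleton ℂ _)
  have hs : ∀ p : ℂ[X], refl (Polynomial.aeval (z + z⁻¹) p) = Polynomial.aeval (z + z⁻¹) p := by
    intro p
    rw [refl_aeval, map_add, map_inv₀, refl_z, inv_inv, add_comm]
  have he : euler (z + z⁻¹) = z - z⁻¹ := by
    have := z_ne_zero
    rw [map_add, euler_inv, euler_z]
    field_simp
    ring
  have key : ∀ (p : ℂ[X]) (g : RatZ), g ∈ laurent → T g ∈ laurent →
      T (Polynomial.aeval (z + z⁻¹) p * g) ∈ laurent := by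
    intro p g hg hTg
    rw [hT _ _ (hs p), euler_aeval, he,
      show ∀ b d : RatZ, a * (b * d) * g = a * d * b * g by intros; ring]
    exact add_mem (mul_mem (mul_mem ha (hp _)) hg) (mul_mem (hp p) hTg)
  intro f hf
  obtain ⟨p, q, rfl⟩ := exists_symmetric_decomposition hf
  rw [map_add, mul_comm z]
  refine add_mem ?_ (key q z z_mem_laurent hz)
  simpa using key p 1 (one_mem _) h1

theorem forward_map_laurent (k : ℂ × ℂ) : ∀ f ∈ laurent, forward k f ∈ laurent := by
  have h0 := z_ne_zero
  have h1 := z_sub_one_ne_zero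
  have h2 := z_add_one_ne_zero
  refine map_laurent_of_twisted_leibniz (a := z / ((z - 1) * (z + 1))) ?_ ?_ ?_ ?_
  · intro h f hh
    rw [forward_apply, forward_apply, euler_mul, map_mul refl, hh]
    ring
  · rw [z_sub_z_inv]
    convert one_mem laurent using 1
    field_simp
  · rw [forward_apply, map_one refl, euler_one]
    simp [laurent.zero_mem]
  · rw [forward_apply, euler_z, refl_z]
    convert zero_mem laurent using 1
    field_simp
    ring

theorem backward_map_laurent (k : ℂ × ℂ) : ∀ f ∈ laurent, backward k f ∈ laurent := by
  have h0 := z_ne_zero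
  have hd : z - z⁻¹ ∈ laurent := sub_mem z_mem_laurent z_inv_mem_laurent
  have hb : ∀ c : ℂ, algebraMap ℂ RatZ c * (z + 1 / z) + algebraMap ℂ RatZ (2 * k.1) + 1 / z
      ∈ laurent := by
    intro c
    rw [one_div]
    exact add_mem (add_mem (mul_mem (C_mem_laurent _) (add_mem z_mem_laurent z_inv_mem_laurent))
      (C_mem_laurent _)) z_inv_mem_laurent
  refine map_laurent_of_twisted_leibniz (a := z - z⁻¹) ?_ ?_ ?_ ?_
  · intro h f hh
    rw [backward_apply, backward_apply, euler_mul, map_mul refl, hh, z_sub_z_inv]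
    ring
  · exact mul_mem hd hd
  · rw [backward_apply, map_one refl, euler_one, mul_one, mul_one, mul_zero, zero_add]
    exact sub_mem (hb _) z_mem_laurent
  · rw [backward_apply, euler_z, refl_z, ← z_sub_z_inv]
    exact sub_mem (add_mem (mul_mem hd z_mem_laurent) (mul_mem (hb _) z_mem_laurent))
      (mul_mem z_mem_laurent z_inv_mem_laurent)

theorem contigPlus_map_laurent (k : ℂ × ℂ) : ∀ f ∈ laurent, contigPlus k f ∈ laurent := by
  have h0 := z_ne_zero
  have h1 := z_sub_one_ne_zero
  have h2 := z_add_one_ne_zero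
  have hz := z_mem_laurent
  refine map_laurent_of_twisted_leibniz (a := (z + 1) / (z - 1)) ?_ ?_ ?_ ?_
  · intro h f hh
    rw [contigPlus_apply, contigPlus_apply, euler_mul, map_mul refl, hh]
    ring
  · have : (z + 1) ^ 2 * z⁻¹ ∈ laurent :=
      mul_mem (pow_mem (add_mem hz (one_mem _)) _) z_inv_mem_laurent
    convert this using 1
    rw [z_sub_z_inv]
    field_simp
  · rw [contigPlus_apply, map_one refl, euler_one]
    simpa using C_mem_laurent (k.2 - 1 / 2)
  · have : z + 1 + algebraMap ℂ RatZ (k.2 - 1 / 2) * z ∈ laurent :=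
      add_mem (add_mem hz (one_mem _)) (mul_mem (C_mem_laurent _) hz)
    convert this using 1
    rw [contigPlus_apply, euler_z, refl_z]
    field_simp
    ring

theorem contigMinus_map_laurent (k : ℂ × ℂ) : ∀ f ∈ laurent, contigMinus k f ∈ laurent := by
  have h0 := z_ne_zero
  have h1 := z_sub_one_ne_zero
  have h2 := z_add_one_ne_zero
  have hz := z_mem_laurent
  refine map_laurent_of_twisted_leibniz (a := (z - 1) / (z + 1)) ?_ ?_ ?_ ?_
  · intro h f hh
    rw [contigMinus_apply, contigMinus_apply, euler_mul, map_mul refl, hh]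
    ring
  · have : (z - 1) ^ 2 * z⁻¹ ∈ laurent :=
      mul_mem (pow_mem (sub_mem hz (one_mem _)) _) z_inv_mem_laurent
    convert this using 1
    rw [z_sub_z_inv]
    field_simp
  · rw [contigMinus_apply, map_one refl, euler_one]
    simpa using C_mem_laurent (k.1 + k.2 - 1 / 2)
  · have : z - 1 + algebraMap ℂ RatZ (k.1 + k.2 - 1 / 2) * z ∈ laurent :=
      add_mem (sub_mem hz (one_mem _)) (mul_mem (C_mem_laurent _) hz)
    convert this using 1
    rw [contigMinus_apply, euler_z, refl_z]
    field_simp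
    ring

theorem mulOp_mem_diffRefl {a : RatZ} (ha : a ∈ laurentLoc) : mulOp a ∈ diffRefl :=
  Algebra.subset_adjoin (Or.inl ⟨a, ha, rfl⟩)

theorem theta_mem_diffRefl : theta ∈ diffRefl := Algebra.subset_adjoin (by simp)

theorem s_mem_diffRefl : s ∈ diffRefl := Algebra.subset_adjoin (by simp)

/-- A first-order operator `a θ + b + c s` is a differential-reflection operator if its
coefficients become Laurent polynomials after multiplication with a power of `z - z⁻¹`. -/
theorem mem_diffRefl_of_apply {T : Op} {a b c : RatZ} (n : ℕ)
    (hT : ∀ f, T f = a * euler f + b * f + c * refl f)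
    (ha : (z - z⁻¹) ^ n * a ∈ laurent) (hb : (z - z⁻¹) ^ n * b ∈ laurent)
    (hc : (z - z⁻¹) ^ n * c ∈ laurent) : T ∈ diffRefl := by
  have hd : z - z⁻¹ ≠ 0 := by
    rw [z_sub_z_inv]
    exact div_ne_zero (mul_ne_zero z_sub_one_ne_zero z_add_one_ne_zero) z_ne_zero
  have key : ∀ x : RatZ, (z - z⁻¹) ^ n * x ∈ laurent → x ∈ laurentLoc := by
    intro x hx
    have := mul_mem (pow_mem disc_inv_mem_laurentLoc n) (laurent_le_laurentLoc hx)
    rwa [← mul_assoc, ← mul_pow, inv_mul_cancel₀ hd, one_pow, one_mul] at this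
  have : T = mulOp a * theta + mulOp b + mulOp c * s := by
    ext f
    exact hT f
  rw [this]
  exact add_mem (add_mem (mul_mem (mulOp_mem_diffRefl (key a ha)) theta_mem_diffRefl)
    (mulOp_mem_diffRefl (key b hb))) (mul_mem (mulOp_mem_diffRefl (key c hc)) s_mem_diffRefl)

theorem cherednik_apply' (k : ℂ × ℂ) (f : RatZ) :
    cherednik k f = 1 * euler f
      + ((algebraMap ℂ RatZ k.1 * (z / (z - 1))
        + algebraMap ℂ RatZ (2 * k.2) * (z ^ 2 / ((z - 1) * (z + 1))))
        - algebraMap ℂ RatZ (rho k)) * f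
      + -(algebraMap ℂ RatZ k.1 * (z / (z - 1))
        + algebraMap ℂ RatZ (2 * k.2) * (z ^ 2 / ((z - 1) * (z + 1)))) * refl f := by
  rw [cherednik_apply]
  ring

theorem cherednik_mem_diffRefl (k : ℂ × ℂ) : cherednik k ∈ diffRefl := by
  have h0 := z_ne_zero
  have h1 := z_sub_one_ne_zero
  have h2 := z_add_one_ne_zero
  have hz := z_mem_laurent
  have hd : z - z⁻¹ ∈ laurent := sub_mem z_mem_laurent z_inv_mem_laurent
  have hu : (z - z⁻¹) * (algebraMap ℂ RatZ k.1 * (z / (z - 1))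
        + algebraMap ℂ RatZ (2 * k.2) * (z ^ 2 / ((z - 1) * (z + 1)))) ∈ laurent := by
    have : algebraMap ℂ RatZ k.1 * (z + 1) + algebraMap ℂ RatZ (2 * k.2) * z ∈ laurent :=
      add_mem (mul_mem (C_mem_laurent _) (add_mem hz (one_mem _))) (mul_mem (C_mem_laurent _) hz)
    convert this using 1
    rw [z_sub_z_inv]
    field_simp
  refine mem_diffRefl_of_apply 1 (cherednik_apply' k) ?_ ?_ ?_
  · simpa using hd
  · rw [pow_one, mul_sub]
    exact sub_mem hu (mul_mem hd (C_mem_laurent _))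
  · rw [pow_one, mul_neg]
    exact neg_mem hu

theorem forward_mem_diffRefl (k : ℂ × ℂ) : forward k ∈ diffRefl := by
  have h0 := z_ne_zero
  have h1 := z_sub_one_ne_zero
  have h2 := z_add_one_ne_zero
  have hd : z - z⁻¹ ∈ laurent := sub_mem z_mem_laurent z_inv_mem_laurent
  have hu : (z - z⁻¹) ^ 2 * (z ^ 3 / ((z - 1) * (z + 1)) ^ 2) ∈ laurent := by
    convert z_mem_laurent using 1
    rw [z_sub_z_inv]
    field_simp
  refine mem_diffRefl_of_apply (a := z / ((z - 1) * (z + 1)))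
    (b := -(z ^ 3 / ((z - 1) * (z + 1)) ^ 2)) (c := z ^ 3 / ((z - 1) * (z + 1)) ^ 2) 2 ?_ ?_ ?_ hu
  · intro f
    rw [forward_apply]
    ring
  · convert hd using 1
    rw [z_sub_z_inv]
    field_simp
  · rw [mul_neg]
    exact neg_mem hu

theorem backward_mem_diffRefl (k : ℂ × ℂ) : backward k ∈ diffRefl := by
  have hd : z - z⁻¹ ∈ laurent := sub_mem z_mem_laurent z_inv_mem_laurent
  refine mem_diffRefl_of_apply (a := z - z⁻¹)
    (b := algebraMap ℂ RatZ (k.1 + 2 * k.2 - 1) * (z + z⁻¹) + algebraMap ℂ RatZ (2 * k.1) + z⁻¹)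
    (c := -z) 0 ?_ ?_ ?_ ?_
  · intro f
    rw [backward_apply, z_sub_z_inv]
    ring
  · simpa using hd
  · rw [pow_zero, one_mul]
    exact add_mem (add_mem (mul_mem (C_mem_laurent _) (add_mem z_mem_laurent z_inv_mem_laurent))
      (C_mem_laurent _)) z_inv_mem_laurent
  · simpa using z_mem_laurent

theorem contigPlus_mem_diffRefl (k : ℂ × ℂ) : contigPlus k ∈ diffRefl := by
  have h0 := z_ne_zero
  have h1 := z_sub_one_ne_zero
  have h2 := z_add_one_ne_zero
  have hz := z_mem_laurent
  have hz' := z_inv_mem_laurent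
  have hd : z - z⁻¹ ∈ laurent := sub_mem z_mem_laurent z_inv_mem_laurent
  have hu : (z - z⁻¹) ^ 2 * (z / (z - 1) ^ 2) ∈ laurent := by
    convert mul_mem hz' (pow_mem (add_mem hz (one_mem _)) 2) using 1
    rw [z_sub_z_inv]
    field_simp
  refine mem_diffRefl_of_apply (a := (z + 1) / (z - 1))
    (b := algebraMap ℂ RatZ (k.2 - 1 / 2) - z / (z - 1) ^ 2) (c := z / (z - 1) ^ 2) 2 ?_ ?_ ?_ hu
  · intro f
    rw [contigPlus_apply]
    ring
  · convert mul_mem hd (mul_mem hz' (pow_mem (add_mem hz (one_mem _)) 2)) using 1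
    rw [z_sub_z_inv]
    field_simp
  · rw [mul_sub]
    exact sub_mem (mul_mem (pow_mem hd 2) (C_mem_laurent _)) hu

theorem contigMinus_mem_diffRefl (k : ℂ × ℂ) : contigMinus k ∈ diffRefl := by
  have h0 := z_ne_zero
  have h1 := z_sub_one_ne_zero
  have h2 := z_add_one_ne_zero
  have hz := z_mem_laurent
  have hz' := z_inv_mem_laurent
  have hd : z - z⁻¹ ∈ laurent := sub_mem z_mem_laurent z_inv_mem_laurent
  have hu : (z - z⁻¹) ^ 2 * (z / (z + 1) ^ 2) ∈ laurent := by
    convert mul_mem hz' (pow_mem (sub_mem hz (one_mem _)) 2) using 1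
    rw [z_sub_z_inv]
    field_simp
  refine mem_diffRefl_of_apply (a := (z - 1) / (z + 1))
    (b := algebraMap ℂ RatZ (k.1 + k.2 - 1 / 2) + z / (z + 1) ^ 2)
    (c := -(z / (z + 1) ^ 2)) 2 ?_ ?_ ?_ ?_
  · intro f
    rw [contigMinus_apply]
    ring
  · convert mul_mem hd (mul_mem hz' (pow_mem (sub_mem hz (one_mem _)) 2)) using 1
    rw [z_sub_z_inv]
    field_simp
  · rw [mul_add]
    exact add_mem (mul_mem (pow_mem hd 2) (C_mem_laurent _)) hu
  · rw [mul_neg]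
    exact neg_mem hu

theorem forward_mem_shiftOps (k : ℂ × ℂ) : forward k ∈ shiftOps (0, 1) k :=
  ⟨forward_mem_diffRefl k, forward_mul_cherednik k, forward_map_laurent k⟩

theorem backward_mem_shiftOps (k : ℂ × ℂ) : backward k ∈ shiftOps (0, -1) k :=
  ⟨backward_mem_diffRefl k, backward_mul_cherednik k, backward_map_laurent k⟩

theorem contigPlus_mem_shiftOps (k : ℂ × ℂ) : contigPlus k ∈ shiftOps (2, -1) k :=
  ⟨contigPlus_mem_diffRefl k, contigPlus_mul_cherednik k, contigPlus_map_laurent k⟩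

theorem contigMinus_mem_shiftOps (k : ℂ × ℂ) : contigMinus k ∈ shiftOps (-2, 1) k :=
  ⟨contigMinus_mem_diffRefl k, contigMinus_mul_cherednik k, contigMinus_map_laurent k⟩

theorem cherednik_map_laurent (k : ℂ × ℂ) : ∀ f ∈ laurent, cherednik k f ∈ laurent := by
  have h0 := z_ne_zero
  have h1 := z_sub_one_ne_zero
  have h2 := z_add_one_ne_zero
  have hz := z_mem_laurent
  refine map_laurent_of_twisted_leibniz (a := 1) ?_ ?_ ?_ ?_
  · intro h f hh
    rw [cherednik_apply, cherednik_apply, euler_mul, map_mul refl, hh]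
    ring
  · rw [one_mul]
    exact sub_mem z_mem_laurent z_inv_mem_laurent
  · rw [cherednik_apply, map_one refl, euler_one]
    simpa only [sub_self, mul_zero, add_zero, zero_sub, mul_one] using neg_mem (C_mem_laurent _)
  · have : z + algebraMap ℂ RatZ k.1 * (z + 1) + algebraMap ℂ RatZ (2 * k.2) * z
        - algebraMap ℂ RatZ (rho k) * z ∈ laurent :=
      sub_mem (add_mem (add_mem hz (mul_mem (C_mem_laurent _) (add_mem hz (one_mem _))))
        (mul_mem (C_mem_laurent _) hz)) (mul_mem (C_mem_laurent _) hz)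
    convert this using 1
    rw [cherednik_apply, euler_z, refl_z]
    field_simp
    ring

theorem cherednik_mem_shiftAlg (k : ℂ × ℂ) : cherednik k ∈ shiftAlg k :=
  ⟨cherednik_mem_diffRefl k, by rw [shift_zero], cherednik_map_laurent k⟩

/-! ### Compositions of elementary operators -/

theorem shift_shift (k : ℂ × ℂ) (l l' : ℤ × ℤ) : shift (shift k l) l' = shift k (l + l') := by
  simp [shift, add_assoc]

theorem chain_mem_shiftOps {F : ℂ × ℂ → Op} {v : ℤ × ℤ} (hF : ∀ k, F k ∈ shiftOps v k)
    (N : ℕ) (k : ℂ × ℂ) : chain F v N k ∈ shiftOps ((N : ℤ) • v) k := by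
  induction N with
  | zero =>
    rw [Nat.cast_zero, zero_smul]
    exact (shiftAlg k).one_mem
  | succ N ih =>
    have := mul_mem_shiftOps (hF _) ih
    rwa [natCast_zsmul, ← succ_nsmul, ← natCast_zsmul] at this

theorem chain_add (F : ℂ × ℂ → Op) (v : ℤ × ℤ) (N N' : ℕ) (k : ℂ × ℂ) :
    chain F v (N + N') k = chain F v N' (shift k ((N : ℤ) • v)) * chain F v N k := by
  induction N' with
  | zero => simp [chain]
  | succ N' ih =>
    rw [← add_assoc, chain, ih, chain, mul_assoc, shift_shift, ← add_smul]
    push_cast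
    rfl

theorem chain_mul_left {F G : ℂ × ℂ → Op} {v w : ℤ × ℤ}
    (h : ∀ k, G (shift k v) * F k = F (shift k w) * G k) (N : ℕ) (k : ℂ × ℂ) :
    G (shift k ((N : ℤ) • v)) * chain F v N k = chain F v N (shift k w) * G k := by
  induction N with
  | zero => simp [chain, shift_zero]
  | succ N ih =>
    have h' := h (shift k ((N : ℤ) • v))
    rw [shift_shift] at h'
    rw [chain, chain, ← mul_assoc, mul_assoc _ _ (G k), ← ih, shift_shift, add_comm w,
      ← shift_shift, ← mul_assoc, ← h']
    simp [add_smul]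

theorem chain_mul_chain {F G : ℂ × ℂ → Op} {v w : ℤ × ℤ}
    (h : ∀ k, G (shift k v) * F k = F (shift k w) * G k) (N N' : ℕ) (k : ℂ × ℂ) :
    chain G w N' (shift k ((N : ℤ) • v)) * chain F v N k
      = chain F v N (shift k ((N' : ℤ) • w)) * chain G w N' k := by
  refine (chain_mul_left (F := G) (G := fun k => chain F v N k) (v := w) (w := (N : ℤ) • v)
    ?_ N' k).symm
  intro k
  exact (chain_mul_left h N k).symm

/-- The composition of `n` operators `F` with shift `v` if `n ≥ 0`, and of `-n` operators `G` with
shift `-v` if `n < 0`. -/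
def signedChain (F G : ℂ × ℂ → Op) (v : ℤ × ℤ) (n : ℤ) (k : ℂ × ℂ) : Op :=
  if 0 ≤ n then chain F v n.natAbs k else chain G (-v) n.natAbs k

theorem forwardPow_eq (n : ℤ) (k : ℂ × ℂ) :
    forwardPow n k = signedChain forward backward (0, 1) n k := rfl

theorem contigPow_eq (m : ℤ) (k : ℂ × ℂ) :
    contigPow m k = signedChain contigPlus contigMinus (2, -1) m k := rfl

theorem natAbs_smul_of_nonneg {n : ℤ} (hn : 0 ≤ n) (v : ℤ × ℤ) : (n.natAbs : ℤ) • v = n • v := by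
  rw [Int.natAbs_of_nonneg hn]

theorem natAbs_smul_of_neg {n : ℤ} (hn : n < 0) (v : ℤ × ℤ) : (n.natAbs : ℤ) • -v = n • v := by
  rw [Int.ofNat_natAbs_of_nonpos hn.le, neg_smul_neg]

theorem signedChain_mem_shiftOps {F G : ℂ × ℂ → Op} {v : ℤ × ℤ} (hF : ∀ k, F k ∈ shiftOps v k)
    (hG : ∀ k, G k ∈ shiftOps (-v) k) (n : ℤ) (k : ℂ × ℂ) :
    signedChain F G v n k ∈ shiftOps (n • v) k := by
  rw [signedChain]
  split_ifs with h
  · rw [← natAbs_smul_of_nonneg h]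
    exact chain_mem_shiftOps hF _ k
  · rw [← natAbs_smul_of_neg (not_le.1 h)]
    exact chain_mem_shiftOps hG _ k

theorem signedChain_add (F G : ℂ × ℂ → Op) (v : ℤ × ℤ) {n n' : ℤ} (h : n.sign = n'.sign)
    (k : ℂ × ℂ) : signedChain F G v (n + n') k
      = signedChain F G v n' (shift k (n • v)) * signedChain F G v n k := by
  by_cases hn : 0 ≤ n
  · have hn' : 0 ≤ n' := by rwa [← Int.sign_nonneg_iff, ← h, Int.sign_nonneg_iff]
    rw [signedChain, signedChain, signedChain, if_pos hn, if_pos hn', if_pos (add_nonneg hn hn'),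
      Int.natAbs_add_of_nonneg hn hn', chain_add, natAbs_smul_of_nonneg hn]
  · have hn' : ¬ 0 ≤ n' := by rwa [← Int.sign_nonneg_iff, ← h, Int.sign_nonneg_iff]
    rw [signedChain, signedChain, signedChain, if_neg hn, if_neg hn', if_neg (by omega),
      Int.natAbs_add_of_nonpos (by omega) (by omega), chain_add, natAbs_smul_of_neg (not_le.1 hn)]

theorem signedChain_comm {F F' G G' : ℂ × ℂ → Op} {v w : ℤ × ℤ}
    (h1 : ∀ k, F (shift k w) * G k = G (shift k v) * F k)
    (h2 : ∀ k, F (shift k (-w)) * G' k = G' (shift k v) * F k)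
    (h3 : ∀ k, F' (shift k w) * G k = G (shift k (-v)) * F' k)
    (h4 : ∀ k, F' (shift k (-w)) * G' k = G' (shift k (-v)) * F' k) (n m : ℤ) (k : ℂ × ℂ) :
    signedChain F F' v n (shift k (m • w)) * signedChain G G' w m k
      = signedChain G G' w m (shift k (n • v)) * signedChain F F' v n k := by
  simp only [signedChain]
  split_ifs with hn hm hm
  · rw [← natAbs_smul_of_nonneg hn, ← natAbs_smul_of_nonneg hm]
    exact chain_mul_chain h1 _ _ k
  · rw [← natAbs_smul_of_nonneg hn, ← natAbs_smul_of_neg (not_le.1 hm)]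
    exact chain_mul_chain h2 _ _ k
  · rw [← natAbs_smul_of_neg (not_le.1 hn), ← natAbs_smul_of_nonneg hm]
    exact chain_mul_chain h3 _ _ k
  · rw [← natAbs_smul_of_neg (not_le.1 hn), ← natAbs_smul_of_neg (not_le.1 hm)]
    exact chain_mul_chain h4 _ _ k

theorem gen_eq (m n : ℤ) (k : ℂ × ℂ) :
    gen (m + m, n - m) k = signedChain contigPlus contigMinus (2, -1) m (shift k (n • (0, 1)))
      * signedChain forward backward (0, 1) n k := by
  have h1 : (m + m) / 2 = m := by omega
  rw [gen, h1, add_sub_cancel, forwardPow_eq, contigPow_eq]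
  simp

theorem smul_add_smul_eq (m n : ℤ) : n • ((0, 1) : ℤ × ℤ) + m • ((2, -1) : ℤ × ℤ)
    = (m + m, n - m) := by
  ext <;> simp <;> ring

theorem exists_eq_of_even {l : ℤ × ℤ} (hl : Even l.1) : ∃ m n : ℤ, l = (m + m, n - m) := by
  obtain ⟨m, hm⟩ := hl
  exact ⟨m, l.2 + m, by ext <;> simp [hm]⟩

theorem gen_mem_shiftOps {l : ℤ × ℤ} (hl : Even l.1) (k : ℂ × ℂ) : gen l k ∈ shiftOps l k := by
  obtain ⟨m, n, rfl⟩ := exists_eq_of_even hl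
  rw [gen_eq, ← smul_add_smul_eq]
  exact mul_mem_shiftOps
    (signedChain_mem_shiftOps contigPlus_mem_shiftOps contigMinus_mem_shiftOps _ _)
    (signedChain_mem_shiftOps forward_mem_shiftOps backward_mem_shiftOps _ _)

theorem gen_add {l l' : ℤ × ℤ} (hl : Even l.1) (hl' : Even l'.1) (h1 : l.1.sign = l'.1.sign)
    (h2 : (l.1 / 2 + l.2).sign = (l'.1 / 2 + l'.2).sign) (k : ℂ × ℂ) :
    gen (l + l') k = gen l' (shift k l) * gen l k := by
  obtain ⟨m, n, rfl⟩ := exists_eq_of_even hl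
  obtain ⟨m', n', rfl⟩ := exists_eq_of_even hl'
  have e1 : ∀ m : ℤ, (m + m) / 2 = m := fun m => by omega
  have hs : ∀ m : ℤ, (m + m).sign = m.sign := fun m => by
    rw [← two_mul, Int.sign_mul, show Int.sign 2 = 1 from rfl, one_mul]
  simp only [e1, add_sub_cancel] at h2
  simp only [hs] at h1
  have e2 : ((m + m, n - m) + (m' + m', n' - m') : ℤ × ℤ)
      = ((m + m') + (m + m'), (n + n') - (m + m')) := by
    ext <;> simp <;> ring
  have hc := signedChain_comm (F := forward) (F' := backward) (G := contigPlus) (G' := contigMinus)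
    (v := (0, 1)) (w := (2, -1)) forward_mul_contigPlus forward_mul_contigMinus
    backward_mul_contigPlus backward_mul_contigMinus n' m (shift k (n • (0, 1)))
  simp only [shift_shift] at hc
  rw [e2, gen_eq, gen_eq, gen_eq, signedChain_add _ _ _ h1, signedChain_add _ _ _ h2,
    ← smul_add_smul_eq m n]
  simp only [shift_shift]
  rw [mul_assoc, ← mul_assoc _ _ (signedChain forward backward (0, 1) n k), add_smul, ← hc]
  simp only [mul_assoc]
  congr 3
  abel

/-! ### Normal forms of differential-reflection operators -/

/-- The coordinate `t = (z - 1) / (z + 1)`. It is odd for the reflection, it vanishes at `z = 1`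
and has its pole at `z = -1`, and `θ t = (1 - t ^ 2) / 2`. The inverse `t⁻¹` has the same
properties with `1` and `-1` interchanged. -/
def t : RatZ := (z - 1) / (z + 1)

theorem t_ne_zero : t ≠ 0 := div_ne_zero z_sub_one_ne_zero z_add_one_ne_zero

theorem refl_t : refl t = -t := by
  have h0 := z_ne_zero
  have h2 := z_add_one_ne_zero
  rw [t, map_div₀, map_sub, map_add, map_one, refl_z, z_inv_sub_one, z_inv_add_one]
  field_simp

theorem euler_t : euler t = (1 - t ^ 2) / 2 := by
  have h2 := z_add_one_ne_zero
  rw [t, euler_div, map_sub, map_add, euler_one, euler_z]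
  field_simp
  ring

theorem refl_t_inv : refl t⁻¹ = -t⁻¹ := by 
  rw [map_inv₀, refl_t]
  exact inv_neg

theorem euler_t_inv : euler t⁻¹ = (1 - t⁻¹ ^ 2) / 2 := by
  have := t_ne_zero
  rw [euler_inv, euler_t]
  field_simp
  ring

theorem one_sub_t_sq_ne_zero : 1 - t ^ 2 ≠ 0 := by
  have h0 := z_ne_zero
  have h2 := z_add_one_ne_zero
  have : 1 - t ^ 2 = 4 * z / (z + 1) ^ 2 := by
    rw [t]
    field_simp
    ring
  rw [this]
  exact div_ne_zero (mul_ne_zero (by norm_num) h0) (pow_ne_zero 2 h2)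

theorem euler_zpow (x : RatZ) (n : ℤ) : euler (x ^ n) = n * x ^ (n - 1) * euler x := by
  rw [Derivation.leibniz_zpow]
  simp [mul_assoc]

/-- The Euler derivation `t ∂_t` in the coordinate `t`. -/
def eulerT : Op := mulOp (2 * t / (1 - t ^ 2)) * theta

theorem eulerT_apply (f : RatZ) : eulerT f = 2 * t / (1 - t ^ 2) * euler f := rfl

theorem euler_eq_eulerT (f : RatZ) : euler f = (1 - t ^ 2) / (2 * t) * eulerT f := by
  have := t_ne_zero
  have := one_sub_t_sq_ne_zero
  rw [eulerT_apply]
  field_simp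

theorem eulerT_zpow (j : ℤ) : eulerT (t ^ j) = j * t ^ j := by
  have := t_ne_zero
  have := one_sub_t_sq_ne_zero
  rw [eulerT_apply, euler_zpow, euler_t, zpow_sub_one₀ t_ne_zero]
  field_simp

theorem eulerT_pow_zpow (i : ℕ) (j : ℤ) : (eulerT ^ i) (t ^ j) = (j : RatZ) ^ i * t ^ j := by
  have h : ∀ f : RatZ, eulerT ((j : RatZ) * f) = j * eulerT f := fun f => by
    rw [← zsmul_eq_mul, map_zsmul, zsmul_eq_mul]
  have h' : ∀ (n : ℕ) (f : RatZ), eulerT ((j : RatZ) ^ n * f) = j ^ n * eulerT f := by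
    intro n
    induction n with
    | zero => simp
    | succ n ih => intro f; rw [pow_succ, mul_assoc, ih, h, mul_assoc]
  induction i with
  | zero => simp
  | succ i ih => rw [pow_succ', Module.End.mul_apply, ih, h', eulerT_zpow]; ring

theorem s_mul_eulerT : s * eulerT = eulerT * s := by
  ext f
  have := t_ne_zero
  have := one_sub_t_sq_ne_zero
  simp only [Module.End.mul_apply, s_apply, eulerT_apply, euler_refl, map_mul, map_div₀, map_sub,
    map_pow, map_one, map_ofNat, refl_t, neg_sq]
  ring

theorem s_mul_s : s * s = 1 := by
  ext f
  exact refl_refl f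

/-- The operator `∑ aᵢ (t ∂_t) ^ i` with symbol the polynomial `∑ aᵢ X ^ i`. -/
def opOf (A : RatZ[X]) : Op := A.sum fun i a => mulOp a * eulerT ^ i

theorem mulOp_add (a b : RatZ) : mulOp (a + b) = mulOp a + mulOp b := map_add _ _ _

theorem mulOp_mul (a b : RatZ) : mulOp (a * b) = mulOp a * mulOp b := map_mul _ _ _

theorem mulOp_zero : mulOp 0 = 0 := map_zero _

theorem opOf_monomial (i : ℕ) (a : RatZ) :
    opOf (Polynomial.monomial i a) = mulOp a * eulerT ^ i :=
  Polynomial.sum_monomial_index _ _ (by rw [mulOp_zero, zero_mul])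

theorem opOf_add (A B : RatZ[X]) : opOf (A + B) = opOf A + opOf B :=
  Polynomial.sum_add_index _ _ _ (fun i => by rw [mulOp_zero, zero_mul])
    (fun i a b => by rw [mulOp_add, add_mul])

theorem opOf_zero : opOf 0 = 0 := Polynomial.sum_zero_index _

theorem opOf_C_mul (a : RatZ) (A : RatZ[X]) : opOf (Polynomial.C a * A) = mulOp a * opOf A := by
  induction A using Polynomial.induction_on' with
  | add A B hA hB => rw [mul_add, opOf_add, opOf_add, hA, hB, mul_add]
  | monomial i b =>
    rw [Polynomial.C_mul_monomial, opOf_monomial, opOf_monomial, mulOp_mul, mul_assoc]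

theorem opOf_zpow (A : RatZ[X]) (j : ℤ) : opOf A (t ^ j) = A.eval (j : RatZ) * t ^ j := by
  induction A using Polynomial.induction_on' with
  | add A B hA hB => rw [opOf_add, LinearMap.add_apply, hA, hB, Polynomial.eval_add, add_mul]
  | monomial i a =>
    rw [opOf_monomial, Module.End.mul_apply, eulerT_pow_zpow, mulOp_apply,
      Polynomial.eval_monomial, mul_assoc]

/-- The polynomial with coefficients `T aᵢ`, where `aᵢ` are the coefficients of `A`. -/
def mapCoeff (T : Op) (A : RatZ[X]) : RatZ[X] := A.sum fun i a => Polynomial.monomial i (T a)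

theorem mapCoeff_monomial (T : Op) (i : ℕ) (a : RatZ) :
    mapCoeff T (Polynomial.monomial i a) = Polynomial.monomial i (T a) :=
  Polynomial.sum_monomial_index _ _ (by rw [map_zero, map_zero])

theorem mapCoeff_add (T : Op) (A B : RatZ[X]) :
    mapCoeff T (A + B) = mapCoeff T A + mapCoeff T B :=
  Polynomial.sum_add_index _ _ _ (fun i => by rw [map_zero, map_zero])
    (fun i a b => by rw [map_add, map_add])

theorem coeff_mapCoeff (T : Op) (A : RatZ[X]) (n : ℕ) :
    (mapCoeff T A).coeff n = T (A.coeff n) := by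
  induction A using Polynomial.induction_on' with
  | add A B hA hB => rw [mapCoeff_add, Polynomial.coeff_add, hA, hB, Polynomial.coeff_add, map_add]
  | monomial i a =>
    rw [mapCoeff_monomial, Polynomial.coeff_monomial, Polynomial.coeff_monomial]
    split_ifs
    · rfl
    · rw [map_zero]

theorem eval_mapCoeff (T : Op) (A : RatZ[X]) (j : ℤ) :
    (mapCoeff T A).eval (j : RatZ) = T (A.eval (j : RatZ)) := by
  induction A using Polynomial.induction_on' with
  | add A B hA hB => rw [mapCoeff_add, Polynomial.eval_add, hA, hB, Polynomial.eval_add, map_add]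
  | monomial i a =>
    rw [mapCoeff_monomial, Polynomial.eval_monomial, Polynomial.eval_monomial, ← Int.cast_pow,
      mul_comm, mul_comm a, ← zsmul_eq_mul, ← zsmul_eq_mul, map_zsmul]

theorem theta_mul_opOf (A : RatZ[X]) : theta * opOf A
    = opOf (Polynomial.C ((1 - t ^ 2) / (2 * t)) * (A * Polynomial.X) + mapCoeff theta A) := by
  induction A using Polynomial.induction_on' with
  | add A B hA hB =>
    rw [opOf_add, mul_add, hA, hB, ← opOf_add, mapCoeff_add]
    congr 1
    ring
  | monomial i a =>
    rw [Polynomial.monomial_mul_X, opOf_add, opOf_C_mul, mapCoeff_monomial, opOf_monomial,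
      opOf_monomial, opOf_monomial]
    ext f
    simp only [LinearMap.add_apply, Module.End.mul_apply, mulOp_apply, theta_apply, euler_mul,
      pow_succ', euler_eq_eulerT ((eulerT ^ i) f)]
    ring

theorem s_mul_opOf (A : RatZ[X]) : s * opOf A = opOf (mapCoeff s A) * s := by
  induction A using Polynomial.induction_on' with
  | add A B hA hB => rw [opOf_add, mul_add, hA, hB, mapCoeff_add, opOf_add, add_mul]
  | monomial i a =>
    have h1 : s * mulOp a = mulOp (s a) * s := by
      ext f
      exact map_mul refl a f
    have h2 : s * eulerT ^ i = eulerT ^ i * s := (Commute.pow_right s_mul_eulerT i)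
    rw [mapCoeff_monomial, opOf_monomial, opOf_monomial, ← mul_assoc, h1, mul_assoc, h2,
      ← mul_assoc]

/-- The operator `∑ aᵢ (t ∂_t) ^ i + ∑ bᵢ (t ∂_t) ^ i s`. -/
def opOf₂ (A B : RatZ[X]) : Op := opOf A + opOf B * s

theorem one_eq_opOf₂ : (1 : Op) = opOf₂ 1 0 := by
  rw [opOf₂, opOf_zero, zero_mul, add_zero, ← Polynomial.monomial_zero_one, opOf_monomial,
    pow_zero, mul_one]
  exact (map_one (Algebra.lmul ℂ RatZ)).symm

theorem opOf₂_add (A B A' B' : RatZ[X]) :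
    opOf₂ (A + A') (B + B') = opOf₂ A B + opOf₂ A' B' := by
  rw [opOf₂, opOf₂, opOf₂, opOf_add, opOf_add, add_mul]
  abel

theorem opOf₂_C_mul (a : RatZ) (A B : RatZ[X]) :
    opOf₂ (Polynomial.C a * A) (Polynomial.C a * B) = mulOp a * opOf₂ A B := by
  rw [opOf₂, opOf₂, opOf_C_mul, opOf_C_mul, mul_add, mul_assoc]

theorem theta_mul_opOf₂ (A B : RatZ[X]) : theta * opOf₂ A B
    = opOf₂ (Polynomial.C ((1 - t ^ 2) / (2 * t)) * (A * Polynomial.X) + mapCoeff theta A)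
      (Polynomial.C ((1 - t ^ 2) / (2 * t)) * (B * Polynomial.X) + mapCoeff theta B) := by
  rw [opOf₂, opOf₂, mul_add, theta_mul_opOf, ← mul_assoc theta, theta_mul_opOf]

theorem s_mul_opOf₂ (A B : RatZ[X]) :
    s * opOf₂ A B = opOf₂ (mapCoeff s B) (mapCoeff s A) := by
  rw [opOf₂, opOf₂, mul_add, s_mul_opOf, ← mul_assoc s, s_mul_opOf, mul_assoc _ s, s_mul_s, mul_one,
    add_comm]

/-- An operator in normal form multiplies `t ^ j` by a rational function that is a polynomial in `j`
for each parity of `j`. -/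
theorem opOf₂_zpow (A B : RatZ[X]) (j : ℤ) : opOf₂ A B (t ^ j)
    = (A.eval (j : RatZ) + (-1) ^ j * B.eval (j : RatZ)) * t ^ j := by
  rw [opOf₂, LinearMap.add_apply, Module.End.mul_apply, s_apply, map_zpow₀ refl, refl_t,
    show -t = -1 * t by ring, mul_zpow, opOf_zpow]
  have h : ∀ f : RatZ, opOf B ((-1) ^ j * f) = (-1) ^ j * opOf B f := by
    intro f
    rcases Int.even_or_odd j with h | h
    · rw [h.neg_one_zpow, one_mul, one_mul]
    · rw [h.neg_one_zpow, neg_one_mul, neg_one_mul, map_neg]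
  rw [h, opOf_zpow]
  ring

theorem opOf₂_zpow_even (A B : RatZ[X]) {j : ℤ} (hj : Even j) :
    opOf₂ A B (t ^ j) = (A + B).eval (j : RatZ) * t ^ j := by
  rw [opOf₂_zpow, hj.neg_one_zpow, one_mul, Polynomial.eval_add]

theorem opOf₂_zpow_odd (A B : RatZ[X]) {j : ℤ} (hj : Odd j) :
    opOf₂ A B (t ^ j) = (A - B).eval (j : RatZ) * t ^ j := by
  rw [opOf₂_zpow, hj.neg_one_zpow, neg_one_mul, ← sub_eq_add_neg, Polynomial.eval_sub]

theorem eq_zero_of_eval_even {K : Type*} [Field K] [CharZero K] {F : K[X]}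
    (h : ∀ j : ℤ, Even j → F.eval (j : K) = 0) : F = 0 := by
  refine Polynomial.eq_zero_of_infinite_isRoot F
    (Set.infinite_of_injective_forall_mem (f := fun n : ℤ => ((2 * n : ℤ) : K)) ?_ ?_)
  · intro a b hab
    have := Int.cast_injective hab
    omega
  · exact fun n => h _ (even_two_mul n)

theorem eq_zero_of_eval_odd {K : Type*} [Field K] [CharZero K] {F : K[X]}
    (h : ∀ j : ℤ, Odd j → F.eval (j : K) = 0) : F = 0 := by
  refine Polynomial.eq_zero_of_infinite_isRoot F
    (Set.infinite_of_injective_forall_mem (f := fun n : ℤ => ((2 * n + 1 : ℤ) : K)) ?_ ?_)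
  · intro a b hab
    have := Int.cast_injective hab
    omega
  · exact fun n => h _ (odd_two_mul_add_one n)

/-- The normal form of a differential-reflection operator is unique. -/
theorem eq_zero_of_opOf₂_eq_zero {A B : RatZ[X]} (h : opOf₂ A B = 0) : A = 0 ∧ B = 0 := by
  have h1 : A + B = 0 := eq_zero_of_eval_even fun j hj => by
    have := opOf₂_zpow_even A B hj
    rw [h, LinearMap.zero_apply] at this
    exact (mul_eq_zero.1 this.symm).resolve_right (zpow_ne_zero _ t_ne_zero)
  have h2 : A - B = 0 := eq_zero_of_eval_odd fun j hj => by
    have := opOf₂_zpow_odd A B hj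
    rw [h, LinearMap.zero_apply] at this
    exact (mul_eq_zero.1 this.symm).resolve_right (zpow_ne_zero _ t_ne_zero)
  have h3 : A = B := sub_eq_zero.1 h2
  have h4 : A = 0 := by
    rw [← h3, ← two_mul] at h1
    exact (mul_eq_zero.1 h1).resolve_left two_ne_zero
  exact ⟨h4, h3 ▸ h4⟩

theorem exists_opOf₂_eq {S : Op} (hS : S ∈ diffRefl) : ∃ A B, S = opOf₂ A B := by
  let M : Submodule ℂ Op :=
    { carrier := {S | ∃ A B, S = opOf₂ A B}
      zero_mem' := ⟨0, 0, by rw [opOf₂, opOf_zero, zero_mul, add_zero]⟩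
      add_mem' := by
        rintro _ _ ⟨A, B, rfl⟩ ⟨A', B', rfl⟩
        exact ⟨A + A', B + B', (opOf₂_add A B A' B').symm⟩
      smul_mem' := by
        rintro c _ ⟨A, B, rfl⟩
        refine ⟨_, _, ((opOf₂_C_mul (algebraMap ℂ RatZ c) A B).trans ?_).symm⟩
        ext f
        exact (Algebra.smul_def c _).symm }
  refine adjoin_mem_of_mul_mem M ⟨1, 0, one_eq_opOf₂⟩ ?_ hS
  rintro x hx _ ⟨A, B, rfl⟩
  rcases hx with ⟨a, -, rfl⟩ | rfl | rfl
  · exact ⟨_, _, (opOf₂_C_mul a A B).symm⟩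
  · exact ⟨_, _, theta_mul_opOf₂ A B⟩
  · exact ⟨_, _, s_mul_opOf₂ A B⟩

/-! ### Symbols and the intertwining relation -/

/-- `S` has order at most `N`, and in its normal form `(t ∂_t) ^ N` has the coefficient `p` and
`(t ∂_t) ^ N s` does not occur. -/
def HasSymbol (S : Op) (N : ℕ) (p : RatZ) : Prop :=
  ∃ A B : RatZ[X], S = opOf₂ A B ∧ (∀ m, N < m → A.coeff m = 0) ∧ (∀ m, N ≤ m → B.coeff m = 0) ∧
    A.coeff N = p

theorem hasSymbol_one : HasSymbol 1 0 1 := by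
  refine ⟨1, 0, one_eq_opOf₂, fun m hm => ?_, fun m _ => Polynomial.coeff_zero m,
    Polynomial.coeff_one_zero⟩
  rw [Polynomial.coeff_one, if_neg hm.ne']

theorem firstOrder_mul_opOf₂ (a b c : RatZ) (A B : RatZ[X]) :
    (mulOp a * theta + mulOp b + mulOp c * s) * opOf₂ A B = opOf₂
      (Polynomial.C (a * ((1 - t ^ 2) / (2 * t))) * (A * Polynomial.X) +
        (Polynomial.C a * mapCoeff theta A + Polynomial.C b * A + Polynomial.C c * mapCoeff s B))
      (Polynomial.C (a * ((1 - t ^ 2) / (2 * t))) * (B * Polynomial.X) +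
        (Polynomial.C a * mapCoeff theta B + Polynomial.C b * B
          + Polynomial.C c * mapCoeff s A)) := by
  rw [add_mul, add_mul, mul_assoc, mul_assoc, theta_mul_opOf₂, s_mul_opOf₂, ← opOf₂_C_mul,
    ← opOf₂_C_mul, ← opOf₂_C_mul, ← opOf₂_add, ← opOf₂_add]
  congr 1 <;> rw [map_mul] <;> ring

theorem coeff_firstOrder_succ {a b c : RatZ} {A B : RatZ[X]} {m : ℕ} (hA : A.coeff (m + 1) = 0)
    (hB : B.coeff (m + 1) = 0) :
    (Polynomial.C (a * ((1 - t ^ 2) / (2 * t))) * (A * Polynomial.X) +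
      (Polynomial.C a * mapCoeff theta A + Polynomial.C b * A
        + Polynomial.C c * mapCoeff s B)).coeff (m + 1)
      = a * ((1 - t ^ 2) / (2 * t)) * A.coeff m := by
  simp only [Polynomial.coeff_add, Polynomial.coeff_C_mul, Polynomial.coeff_mul_X, coeff_mapCoeff,
    hA, hB, map_zero, mul_zero, add_zero]

theorem HasSymbol.firstOrder_mul {S : Op} {N : ℕ} {p : RatZ} (hS : HasSymbol S N p) (a b c : RatZ) :
    HasSymbol ((mulOp a * theta + mulOp b + mulOp c * s) * S) (N + 1)
      (a * ((1 - t ^ 2) / (2 * t)) * p) := by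
  obtain ⟨A, B, rfl, hA, hB, rfl⟩ := hS
  refine ⟨_, _, firstOrder_mul_opOf₂ a b c A B, ?_, ?_, ?_⟩
  · rintro (_ | m) hm
    · omega
    · rw [coeff_firstOrder_succ (hA _ (by omega)) (hB _ (by omega)), hA _ (by omega), mul_zero]
  · rintro (_ | m) hm
    · omega
    · rw [coeff_firstOrder_succ (hB _ (by omega)) (hA _ (by omega)), hB _ (by omega), mul_zero]
  · rw [coeff_firstOrder_succ (hA _ (by omega)) (hB _ (by omega))]

theorem coordFactor_ne_zero : (1 - t ^ 2) / (2 * t) ≠ 0 :=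
  div_ne_zero one_sub_t_sq_ne_zero (mul_ne_zero two_ne_zero t_ne_zero)

theorem eq_zero_of_firstOrder_mul_eq_zero {a b c : RatZ} (ha : a ≠ 0) {A B : RatZ[X]}
    (h : (mulOp a * theta + mulOp b + mulOp c * s) * opOf₂ A B = 0) : opOf₂ A B = 0 := by
  rw [firstOrder_mul_opOf₂] at h
  obtain ⟨h1, h2⟩ := eq_zero_of_opOf₂_eq_zero h
  -- descending induction on the degree, starting above the degrees of `A` and `B`
  have key : ∀ d m, A.natDegree + B.natDegree + 1 ≤ m + d → A.coeff m = 0 ∧ B.coeff m = 0 := by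
    intro d
    induction d with
    | zero =>
      intro m hm
      exact ⟨Polynomial.coeff_eq_zero_of_natDegree_lt (by omega),
        Polynomial.coeff_eq_zero_of_natDegree_lt (by omega)⟩
    | succ d ih =>
      intro m hm
      obtain ⟨hA, hB⟩ := ih (m + 1) (by omega)
      have e1 := coeff_firstOrder_succ (a := a) (b := b) (c := c) hA hB
      have e2 := coeff_firstOrder_succ (a := a) (b := b) (c := c) hB hA
      rw [h1, Polynomial.coeff_zero] at e1
      rw [h2, Polynomial.coeff_zero] at e2
      exact ⟨(mul_eq_zero.1 e1.symm).resolve_left (mul_ne_zero ha coordFactor_ne_zero),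
        (mul_eq_zero.1 e2.symm).resolve_left (mul_ne_zero ha coordFactor_ne_zero)⟩
  have hA : A = 0 := Polynomial.ext fun m => (key _ m le_add_self).1
  have hB : B = 0 := Polynomial.ext fun m => (key _ m le_add_self).2
  rw [hA, hB, opOf₂, opOf_zero, zero_mul, add_zero]

/-- The Cherednik operator in the coordinate `t`: up to the factor `1 / 2`, it is a rank one
Dunkl operator with parameter `k₁ + k₂` near `t = 0` and with parameter `k₂` near `t = ∞`. -/
theorem cherednik_apply_coord (k : ℂ × ℂ) (f : RatZ) :
    cherednik k f = euler f
      + (algebraMap ℂ RatZ (k.1 + k.2) * t⁻¹ + algebraMap ℂ RatZ k.2 * t) / 2 * (f - refl f)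
      - algebraMap ℂ RatZ (rho k) * refl f := by
  have h0 := z_ne_zero
  have h1 := z_sub_one_ne_zero
  have h2 := z_add_one_ne_zero
  rw [cherednik_apply, t, rho]
  simp only [map_add, map_mul, map_div₀, map_ofNat]
  field_simp
  ring

theorem cherednik_apply_coord_inv (k : ℂ × ℂ) (f : RatZ) :
    cherednik k f = euler f
      + (algebraMap ℂ RatZ k.2 * t⁻¹⁻¹ + algebraMap ℂ RatZ (k.1 + k.2) * t⁻¹) / 2 * (f - refl f)
      - algebraMap ℂ RatZ (rho k) * refl f := by
  rw [cherednik_apply_coord, inv_inv]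
  ring

/-- The intertwining relation `S D = D' S` on the powers of a coordinate `w`, on which `S` acts by
the scalars `Φ j`. -/
theorem intertwine_zpow {w : RatZ} (hw : w ≠ 0) (hr : refl w = -w)
    (he : euler w = (1 - w ^ 2) / 2) {κ₀ κ₁ ρ κ₀' κ₁' ρ' : ℂ} {D D' S : Op}
    (hD : ∀ f, D f = euler f + (algebraMap ℂ RatZ κ₀ * w⁻¹ + algebraMap ℂ RatZ κ₁ * w) / 2
      * (f - refl f) - algebraMap ℂ RatZ ρ * refl f)
    (hD' : ∀ f, D' f = euler f + (algebraMap ℂ RatZ κ₀' * w⁻¹ + algebraMap ℂ RatZ κ₁' * w) / 2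
      * (f - refl f) - algebraMap ℂ RatZ ρ' * refl f)
    (hS : S * D = D' * S) {Φ : ℤ → RatZ} (hΦ : ∀ j, S (w ^ j) = Φ j * w ^ j) (j : ℤ) {ε : ℂ}
    (hε : (-1) ^ j = ε) :
    algebraMap ℂ RatZ (j + κ₀ * (1 - ε)) * w⁻¹ * Φ (j - 1)
      + algebraMap ℂ RatZ (-j + κ₁ * (1 - ε)) * w * Φ (j + 1)
      - algebraMap ℂ RatZ (2 * ρ * ε) * Φ j
    = 2 * euler (Φ j) + j * (w⁻¹ - w) * Φ j
      + (algebraMap ℂ RatZ κ₀' * w⁻¹ + algebraMap ℂ RatZ κ₁' * w)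
        * (Φ j - algebraMap ℂ RatZ ε * refl (Φ j))
      - algebraMap ℂ RatZ (2 * ρ' * ε) * refl (Φ j) := by
  have hrj : refl (w ^ j) = algebraMap ℂ RatZ ε * w ^ j := by
    rw [map_zpow₀, hr, show -w = -1 * w by ring, mul_zpow, ← hε, map_zpow₀, map_neg, map_one]
  have hej : euler (w ^ j) = j * w ^ j * ((w⁻¹ - w) / 2) := by
    rw [euler_zpow, he, zpow_sub_one₀ hw]
    field_simp
  have hDj : D (w ^ j) = ((j + κ₀ * (1 - ε)) / 2) • w ^ (j - 1)
      + ((-j + κ₁ * (1 - ε)) / 2) • w ^ (j + 1) - (ρ * ε) • w ^ j := by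
    rw [hD, hrj, hej, zpow_sub_one₀ hw, zpow_add_one₀ hw]
    simp only [Algebra.smul_def, map_div₀, map_add, map_mul, map_sub, map_one, map_neg, map_ofNat,
      map_intCast]
    field_simp
    ring
  have h := congr($hS (w ^ j))
  rw [Module.End.mul_apply, Module.End.mul_apply, hDj, hΦ, hD', map_sub, map_add, map_smul,
    map_smul, map_smul, hΦ, hΦ, hΦ, euler_mul, hej, map_mul refl, hrj, zpow_sub_one₀ hw,
    zpow_add_one₀ hw] at h
  simp only [Algebra.smul_def, map_div₀, map_add, map_mul, map_sub, map_one, map_neg, map_ofNat,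
      map_intCast] at h ⊢
  have hwj : w ^ j ≠ 0 := zpow_ne_zero j hw
  refine mul_right_cancel₀ hwj ?_
  linear_combination 2 * h

theorem coeff_taylor_of_le {R : Type*} [CommRing R] {f : R[X]} {n : ℕ}
    (hf : ∀ m, n + 1 < m → f.coeff m = 0) (r : R) :
    (Polynomial.taylor r f).coeff n = f.coeff n + (n + 1) * r * f.coeff (n + 1) := by
  have h : (Polynomial.hasseDeriv n f).natDegree ≤ 1 := by
    rw [Polynomial.natDegree_le_iff_coeff_eq_zero]
    intro m hm
    rw [Polynomial.hasseDeriv_coeff, hf _ (by omega), mul_zero]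
  rw [Polynomial.taylor_coeff, Polynomial.eq_X_add_C_of_natDegree_le_one h]
  simp only [Polynomial.hasseDeriv_coeff, Polynomial.eval_add, Polynomial.eval_mul,
    Polynomial.eval_C, Polynomial.eval_X, zero_add, Nat.choose_self, add_comm 1 n,
    Nat.choose_succ_self_right]
  push_cast
  ring

theorem coeff_taylor_of_lt {R : Type*} [CommRing R] {f : R[X]} {n : ℕ}
    (hf : ∀ m, n < m → f.coeff m = 0) (r : R) : (Polynomial.taylor r f).coeff n = f.coeff n := by
  rw [coeff_taylor_of_le (fun m hm => hf m (by omega)), hf _ (Nat.lt_succ_self n), mul_zero,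
    add_zero]

theorem coeff_X_mul_taylor {R : Type*} [CommRing R] {f : R[X]} {n : ℕ}
    (hf : ∀ m, n < m → f.coeff m = 0) (r : R) :
    (Polynomial.X * Polynomial.taylor r f).coeff n
      = (Polynomial.X * f).coeff n + n * r * f.coeff n := by
  cases n with
  | zero => simp
  | succ n =>
    rw [Polynomial.coeff_X_mul, Polynomial.coeff_X_mul, coeff_taylor_of_le hf]
    push_cast
    ring

/-- Comparison of the coefficients of `X ^ (N + 1)` and `X ^ N` in the intertwining relation, where
`F` and `G` are the polynomials by which the operator acts on the powers of the coordinate of one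
parity and of the other parity. -/
theorem coeff_intertwine {F G : RatZ[X]} {N : ℕ} (hF : ∀ m, N < m → F.coeff m = 0)
    (hG : ∀ m, N < m → G.coeff m = 0) {w c₀ c₁ r u e r' : RatZ}
    (h : Polynomial.C w⁻¹ * (Polynomial.X * Polynomial.taylor (-1) G
        + Polynomial.C c₀ * Polynomial.taylor (-1) G)
      + Polynomial.C w * (-(Polynomial.X * Polynomial.taylor 1 G)
        + Polynomial.C c₁ * Polynomial.taylor 1 G) - Polynomial.C r * F
      = Polynomial.C 2 * mapCoeff theta F + Polynomial.C (w⁻¹ - w) * (Polynomial.X * F)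
      + Polynomial.C u * (F - Polynomial.C e * mapCoeff s F) - Polynomial.C r' * mapCoeff s F) :
    (w⁻¹ - w) * G.coeff N = (w⁻¹ - w) * F.coeff N ∧
    w⁻¹ * ((Polynomial.X * G).coeff N - N * G.coeff N + c₀ * G.coeff N)
      + w * (-(Polynomial.X * G).coeff N - N * G.coeff N + c₁ * G.coeff N) - r * F.coeff N
      = 2 * euler (F.coeff N) + (w⁻¹ - w) * (Polynomial.X * F).coeff N
      + u * (F.coeff N - e * refl (F.coeff N)) - r' * refl (F.coeff N) := by
  have hG' : ∀ (r : RatZ), (Polynomial.taylor r G).coeff (N + 1) = 0 := fun r => by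
    rw [coeff_taylor_of_lt fun m hm => hG m (by omega), hG _ (by omega)]
  constructor
  · have h1 := congr(Polynomial.coeff $h (N + 1))
    simp only [Polynomial.coeff_add, Polynomial.coeff_sub, Polynomial.coeff_neg,
      Polynomial.coeff_C_mul, Polynomial.coeff_X_mul, coeff_mapCoeff, hG', hF (N + 1) (by omega),
      coeff_taylor_of_lt hG, map_zero] at h1
    linear_combination h1
  · have h1 := congr(Polynomial.coeff $h N)
    simp only [Polynomial.coeff_add, Polynomial.coeff_sub, Polynomial.coeff_neg,
      Polynomial.coeff_C_mul, coeff_mapCoeff, coeff_X_mul_taylor hG,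
      coeff_taylor_of_lt hG, theta_apply, s_apply] at h1
    linear_combination h1

/-- The symbol of a solution of `S D_k = D_{k'} S` of order at most `N`: the term
`(t ∂_t) ^ N s` does not occur, and the coefficient of `(t ∂_t) ^ N` solves a first-order linear
differential equation that depends only on `N`, `k` and `k'`. -/
theorem symbol_of_intertwine {k k' : ℂ × ℂ} {A B : RatZ[X]}
    (hS : opOf₂ A B * cherednik k = cherednik k' * opOf₂ A B) {N : ℕ}
    (hA : ∀ m, N < m → A.coeff m = 0) (hB : ∀ m, N < m → B.coeff m = 0) :
    B.coeff N = 0 ∧ 2 * euler (A.coeff N)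
      = ((algebraMap ℂ RatZ (k.1 + k.2) - algebraMap ℂ RatZ (k'.1 + k'.2) - N) * t⁻¹
        + (algebraMap ℂ RatZ k.2 - algebraMap ℂ RatZ k'.2 - N) * t) * A.coeff N := by
  have key := fun j ε => intertwine_zpow t_ne_zero refl_t euler_t (cherednik_apply_coord k)
    (cherednik_apply_coord k') hS (opOf₂_zpow A B) j (ε := ε)
  have hadd : ∀ m, N < m → (A + B).coeff m = 0 := fun m hm => by
    rw [Polynomial.coeff_add, hA m hm, hB m hm, add_zero]
  have hsub : ∀ m, N < m → (A - B).coeff m = 0 := fun m hm => by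
    rw [Polynomial.coeff_sub, hA m hm, hB m hm, sub_zero]
  have hne : t⁻¹ - t ≠ 0 := by
    have : t⁻¹ - t = (1 - t ^ 2) / t := by
      have := t_ne_zero
      field_simp
    rw [this]
    exact div_ne_zero one_sub_t_sq_ne_zero t_ne_zero
  obtain ⟨h1, h2⟩ := coeff_intertwine hadd hsub (w := t) (c₀ := 0) (c₁ := 0)
    (r := algebraMap ℂ RatZ (2 * rho k)) (r' := algebraMap ℂ RatZ (2 * rho k'))
    (u := algebraMap ℂ RatZ (k'.1 + k'.2) * t⁻¹ + algebraMap ℂ RatZ k'.2 * t) (e := 1) (by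
      rw [← sub_eq_zero]
      refine eq_zero_of_eval_even fun j hj => ?_
      have h := key j 1 hj.neg_one_zpow
      rw [hj.neg_one_zpow, (hj.sub_odd odd_one).neg_one_zpow,
        (hj.add_odd odd_one).neg_one_zpow] at h
      simp only [Polynomial.eval_add, Polynomial.eval_sub, Polynomial.eval_neg,
        Polynomial.eval_mul, Polynomial.eval_C, Polynomial.eval_X, Polynomial.taylor_eval,
        eval_mapCoeff, theta_apply, s_apply]
      simp only [one_mul, neg_one_mul, map_add, map_mul, map_neg, map_one, map_intCast, map_ofNat,
        Int.cast_add, Int.cast_neg, Int.cast_one, sub_eq_add_neg] at h ⊢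
      linear_combination h)
  obtain ⟨h3, h4⟩ := coeff_intertwine hsub hadd (w := t)
    (c₀ := algebraMap ℂ RatZ (2 * (k.1 + k.2))) (c₁ := algebraMap ℂ RatZ (2 * k.2))
    (r := -algebraMap ℂ RatZ (2 * rho k)) (r' := -algebraMap ℂ RatZ (2 * rho k'))
    (u := algebraMap ℂ RatZ (k'.1 + k'.2) * t⁻¹ + algebraMap ℂ RatZ k'.2 * t) (e := -1) (by
      rw [← sub_eq_zero]
      refine eq_zero_of_eval_odd fun j hj => ?_
      have h := key j (-1) hj.neg_one_zpow
      rw [hj.neg_one_zpow, (hj.sub_odd odd_one).neg_one_zpow,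
        (hj.add_odd odd_one).neg_one_zpow] at h
      simp only [Polynomial.eval_add, Polynomial.eval_sub, Polynomial.eval_neg,
        Polynomial.eval_mul, Polynomial.eval_C, Polynomial.eval_X, Polynomial.taylor_eval,
        eval_mapCoeff, theta_apply, s_apply]
      simp only [one_mul, neg_one_mul, map_add, map_mul, map_neg, map_one, map_intCast, map_ofNat,
        Int.cast_add, Int.cast_neg, Int.cast_one, sub_eq_add_neg] at h ⊢
      linear_combination h)
  have hBN : B.coeff N = 0 := by
    have := mul_left_cancel₀ hne h1
    rw [Polynomial.coeff_add, Polynomial.coeff_sub] at this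
    have h5 : 2 * B.coeff N = 0 := by linear_combination -this
    exact (mul_eq_zero.1 h5).resolve_left two_ne_zero
  refine ⟨hBN, ?_⟩
  simp only [Polynomial.coeff_add, Polynomial.coeff_sub, hBN, add_zero, sub_zero, map_mul, map_add,
    map_ofNat] at h2 h4 ⊢
  -- in the sum over the two parities, the coefficients of lower order and the reflections cancel
  linear_combination (-1 / 2 : RatZ) * h2 - 1 / 2 * h4

/-! ### Values of rational functions at a point -/

/-- The rational function `x` has no pole at `z = e` and has the value `c` there. -/
def HasValue (e : ℂ) (x : RatZ) (c : ℂ) : Prop :=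
  ∃ p q : ℂ[X], q.eval e ≠ 0 ∧ x * Polynomial.aeval z q = Polynomial.aeval z p ∧
    p.eval e = c * q.eval e

section LocalCoordinate

variable {e : ℂ}

theorem hasValue_aeval (p : ℂ[X]) : HasValue e (Polynomial.aeval z p) (p.eval e) :=
  ⟨p, 1, by simp, by simp, by simp⟩

theorem hasValue_C (c : ℂ) : HasValue e (algebraMap ℂ RatZ c) c := by
  simpa using hasValue_aeval (e := e) (Polynomial.C c)

theorem HasValue.add {x y : RatZ} {c d : ℂ} (hx : HasValue e x c) (hy : HasValue e y d) :
    HasValue e (x + y) (c + d) := by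
  obtain ⟨p, q, hq, h, hc⟩ := hx
  obtain ⟨p', q', hq', h', hc'⟩ := hy
  refine ⟨p * q' + p' * q, q * q', by simp [hq, hq'], ?_, ?_⟩
  · simp only [map_add, map_mul]
    linear_combination Polynomial.aeval z q' * h + Polynomial.aeval z q * h'
  · simp only [Polynomial.eval_add, Polynomial.eval_mul]
    linear_combination q'.eval e * hc + q.eval e * hc'

theorem HasValue.mul {x y : RatZ} {c d : ℂ} (hx : HasValue e x c) (hy : HasValue e y d) :
    HasValue e (x * y) (c * d) := by
  obtain ⟨p, q, hq, h, hc⟩ := hx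
  obtain ⟨p', q', hq', h', hc'⟩ := hy
  refine ⟨p * p', q * q', by simp [hq, hq'], ?_, ?_⟩
  · rw [map_mul, map_mul, ← h, ← h']
    ring
  · rw [Polynomial.eval_mul, Polynomial.eval_mul, hc, hc']
    ring

theorem HasValue.unique {x : RatZ} {c d : ℂ} (hx : HasValue e x c) (hy : HasValue e x d) :
    c = d := by
  obtain ⟨p, q, hq, h, hc⟩ := hx
  obtain ⟨p', q', hq', h', hc'⟩ := hy
  have h1 : Polynomial.aeval z (p * q' - p' * q) = 0 := by
    rw [map_sub, map_mul, map_mul, ← h, ← h']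
    ring
  have h2 : p * q' - p' * q = 0 := by
    by_contra h
    exact aeval_z_ne_zero h h1
  have h3 := congr(Polynomial.eval e $h2)
  rw [Polynomial.eval_sub, Polynomial.eval_mul, Polynomial.eval_mul, hc, hc',
    Polynomial.eval_zero] at h3
  have h4 : (c - d) * (q.eval e * q'.eval e) = 0 := by linear_combination h3
  exact sub_eq_zero.1 ((mul_eq_zero.1 h4).resolve_right (mul_ne_zero hq hq'))

theorem HasValue.inv {x : RatZ} {c : ℂ} (hx : HasValue e x c) (hc : c ≠ 0) :
    HasValue e x⁻¹ c⁻¹ := by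
  obtain ⟨p, q, hq, h, hpq⟩ := hx
  have hp : p.eval e ≠ 0 := by rw [hpq]; exact mul_ne_zero hc hq
  have hp0 : p ≠ 0 := fun h => hp (by rw [h, Polynomial.eval_zero])
  have hx0 : x ≠ 0 := fun hx0 => aeval_z_ne_zero hp0 (by rw [← h, hx0, zero_mul])
  refine ⟨q, p, hp, ?_, ?_⟩
  · rw [← h, inv_mul_cancel_left₀ hx0]
  · rw [hpq, inv_mul_cancel_left₀ hc]

theorem HasValue.pow {x : RatZ} {c : ℂ} (hx : HasValue e x c) (n : ℕ) :
    HasValue e (x ^ n) (c ^ n) := by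
  induction n with
  | zero => simpa using hasValue_C (e := e) 1
  | succ n ih => rw [pow_succ, pow_succ]; exact ih.mul hx

theorem HasValue.zpow {x : RatZ} {c : ℂ} (hx : HasValue e x c) (hc : c ≠ 0) (n : ℤ) :
    HasValue e (x ^ n) (c ^ n) := by
  cases n with
  | ofNat n => simpa using hx.pow n
  | negSucc n =>
    rw [zpow_negSucc, zpow_negSucc]
    exact (hx.pow _).inv (pow_ne_zero _ hc)

theorem HasValue.refl (he : e ^ 2 = 1) {x : RatZ} {c : ℂ} (hx : HasValue e x c) :
    HasValue e (refl x) c := by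
  obtain ⟨p, q, hq, h, hc⟩ := hx
  have he0 : e ≠ 0 := by rintro rfl; simp at he
  have hei : e⁻¹ = e := (eq_inv_of_mul_eq_one_left (by rw [← sq, he])).symm
  have hz : HasValue e z⁻¹ e := by
    have := (hasValue_aeval (e := e) Polynomial.X).inv (by simpa using he0)
    simpa [hei] using this
  have hpoly : ∀ p : ℂ[X], HasValue e (Polynomial.aeval (z⁻¹ : RatZ) p) (p.eval e) := by
    intro p
    induction p using Polynomial.induction_on' with
    | add p q hp hq =>
      rw [map_add, Polynomial.eval_add]
      exact hp.add hq
    | monomial n a =>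
      rw [Polynomial.aeval_monomial, Polynomial.eval_monomial]
      exact (hasValue_C a).mul (hz.pow n)
  have h1 := congr(BCOne.refl $h)
  rw [map_mul, refl_aeval, refl_aeval, refl_z] at h1
  have hq0 : Polynomial.aeval (z⁻¹ : RatZ) q ≠ 0 := by
    have hq1 : q ≠ 0 := fun h => hq (by rw [h, Polynomial.eval_zero])
    exact fun h => hq1 (transcendental_iff.1 transcendental_z_inv q h)
  have h2 : BCOne.refl x
      = Polynomial.aeval (z⁻¹ : RatZ) p * (Polynomial.aeval (z⁻¹ : RatZ) q)⁻¹ := by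
    rw [← h1, mul_inv_cancel_right₀ hq0]
  have h3 : c = p.eval e * (q.eval e)⁻¹ := by rw [hc, mul_inv_cancel_right₀ hq]
  rw [h2, h3]
  exact (hpoly p).mul ((hpoly q).inv hq)

/-- The rational functions without pole at `z = e`. -/
def regular (e : ℂ) : Subalgebra ℂ RatZ where
  carrier := {x | ∃ c, HasValue e x c}
  add_mem' := fun ⟨_, h⟩ ⟨_, h'⟩ => ⟨_, h.add h'⟩
  mul_mem' := fun ⟨_, h⟩ ⟨_, h'⟩ => ⟨_, h.mul h'⟩
  algebraMap_mem' := fun c => ⟨c, hasValue_C c⟩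

theorem HasValue.mem_regular {x : RatZ} {c : ℂ} (hx : HasValue e x c) : x ∈ regular e := ⟨c, hx⟩

theorem C_mem_regular (c : ℂ) : algebraMap ℂ RatZ c ∈ regular e := (regular e).algebraMap_mem c

theorem intCast_mem_regular (n : ℤ) : (n : RatZ) ∈ regular e := intCast_mem (regular e) n

theorem refl_mem_regular (he : e ^ 2 = 1) {x : RatZ} (hx : x ∈ regular e) : refl x ∈ regular e :=
  let ⟨_, h⟩ := hx
  (h.refl he).mem_regular

theorem euler_mem_regular {x : RatZ} (hx : x ∈ regular e) : euler x ∈ regular e := by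
  obtain ⟨c, p, q, hq, h, -⟩ := hx
  have hq0 : Polynomial.aeval (z : RatZ) q ≠ 0 :=
    aeval_z_ne_zero fun h => hq (by rw [h, Polynomial.eval_zero])
  have hx : x = Polynomial.aeval z p / Polynomial.aeval z q := by
    rw [← h, mul_div_cancel_right₀ _ hq0]
  have hr : ∀ p : ℂ[X], Polynomial.aeval (z : RatZ) p ∈ regular e := fun p =>
    (hasValue_aeval p).mem_regular
  have hz : z ∈ regular e := by simpa using hr Polynomial.X
  rw [hx, euler_div, euler_aeval, euler_aeval, euler_z]
  exact mul_mem (pow_mem ((hasValue_aeval q).inv hq).mem_regular 2)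
    (sub_mem (mul_mem (hr _) (mul_mem (hr _) hz)) (mul_mem (hr _) (mul_mem (hr _) hz)))

theorem laurent_le_regular (he : e ≠ 0) : laurent ≤ regular e := by
  have hz : HasValue e z e := by simpa using hasValue_aeval (e := e) Polynomial.X
  refine Algebra.adjoin_le ?_
  rintro x (rfl | rfl)
  · exact hz.mem_regular
  · exact (hz.inv he).mem_regular

theorem exists_eq_mul_of_hasValue_zero {x : RatZ} (hx : HasValue e x 0) :
    ∃ y ∈ regular e, x = (z - algebraMap ℂ RatZ e) * y := by
  obtain ⟨p, q, hq, h, hp⟩ := hx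
  rw [zero_mul] at hp
  obtain ⟨p', rfl⟩ := Polynomial.dvd_iff_isRoot.2 hp
  have hq0 : Polynomial.aeval (z : RatZ) q ≠ 0 :=
    aeval_z_ne_zero fun h => hq (by rw [h, Polynomial.eval_zero])
  refine ⟨Polynomial.aeval z p' * (Polynomial.aeval z q)⁻¹,
    ((hasValue_aeval p').mul ((hasValue_aeval q).inv hq)).mem_regular, ?_⟩
  rw [map_mul, map_sub, Polynomial.aeval_X, Polynomial.aeval_C] at h
  rw [← mul_assoc, ← h, mul_inv_cancel_right₀ hq0]

/-- The Taylor expansion of a regular function at `z = e` up to order `R`. -/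
theorem exists_polynomial_approx {x : RatZ} (hx : x ∈ regular e) (R : ℕ) :
    ∃ f : ℂ[X], ∃ y ∈ regular e,
      x = Polynomial.aeval z f + (z - algebraMap ℂ RatZ e) ^ R * y := by
  induction R with
  | zero => exact ⟨0, x, hx, by simp⟩
  | succ R ih =>
    obtain ⟨f, y, ⟨c, hc⟩, rfl⟩ := ih
    have h : HasValue e (y + algebraMap ℂ RatZ (-c)) 0 := by
      simpa using hc.add (hasValue_C (-c))
    obtain ⟨y', hy', h'⟩ := exists_eq_mul_of_hasValue_zero h
    refine ⟨f + (Polynomial.X - Polynomial.C e) ^ R * Polynomial.C c, y', hy', ?_⟩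
    simp only [map_add, map_mul, map_pow, map_sub, Polynomial.aeval_X, Polynomial.aeval_C]
    rw [map_neg] at h'
    linear_combination (z - algebraMap ℂ RatZ e) ^ R * h'

/-! ### A local coordinate at `z = ± 1` -/

variable {w : RatZ}

theorem hasValue_z_add (he : e ^ 2 = 1) :
    HasValue e (z + algebraMap ℂ RatZ e) (2 * e) ∧ 2 * e ≠ 0 := by
  have he0 : e ≠ 0 := by rintro rfl; simp at he
  refine ⟨?_, mul_ne_zero two_ne_zero he0⟩
  simpa [two_mul] using (hasValue_aeval (e := e) Polynomial.X).add (hasValue_C e)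

theorem z_sub_C_ne_zero (c : ℂ) : z - algebraMap ℂ RatZ c ≠ 0 := fun h => z_ne_C c (sub_eq_zero.1 h)

theorem z_add_C_ne_zero (c : ℂ) : z + algebraMap ℂ RatZ c ≠ 0 := by
  have := z_sub_C_ne_zero (-c)
  rwa [map_neg, sub_neg_eq_add] at this

/-- Every nonzero rational function has an order of vanishing `n` at `z = e`, and a leading
coefficient with respect to the coordinate `w = (z - e) / (z + e)`. -/
theorem exists_leading (he : e ^ 2 = 1)
    (hw : w = (z - algebraMap ℂ RatZ e) / (z + algebraMap ℂ RatZ e))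
    {x : RatZ} (hx : x ≠ 0) : ∃ n : ℤ, ∃ c : ℂ, c ≠ 0 ∧ HasValue e (w ^ (-n) * x) c := by
  obtain ⟨p, q, hq, -, rfl⟩ := exists_eq_aeval_div x
  have hp : p ≠ 0 := by
    rintro rfl
    simp at hx
  obtain ⟨p', hp1, hp2⟩ := Polynomial.exists_eq_pow_rootMultiplicity_mul_and_not_dvd p hp e
  obtain ⟨q', hq1, hq2⟩ := Polynomial.exists_eq_pow_rootMultiplicity_mul_and_not_dvd q hq e
  rw [Polynomial.dvd_iff_isRoot] at hp2 hq2
  generalize p.rootMultiplicity e = a at *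
  generalize q.rootMultiplicity e = b at *
  obtain ⟨hz, hz'⟩ := hasValue_z_add he
  have h1 := z_sub_C_ne_zero e
  have h2 := z_add_C_ne_zero e
  refine ⟨a - b, (2 * e) ^ ((a : ℤ) - b) * (p'.eval e * (q'.eval e)⁻¹),
    mul_ne_zero (zpow_ne_zero _ hz') (mul_ne_zero hp2 (inv_ne_zero hq2)), ?_⟩
  have : w ^ (-((a : ℤ) - b)) * (Polynomial.aeval z p / Polynomial.aeval z q)
      = (z + algebraMap ℂ RatZ e) ^ ((a : ℤ) - b)
        * (Polynomial.aeval z p' * (Polynomial.aeval z q')⁻¹) := by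
    have h3 : Polynomial.aeval (z : RatZ) q' ≠ 0 :=
      aeval_z_ne_zero fun h => hq2 (by rw [h]; simp)
    rw [hp1, hq1, hw, neg_sub, div_zpow, zpow_sub₀ h1, zpow_sub₀ h2, zpow_sub₀ h2]
    simp only [zpow_natCast, map_mul, map_pow, map_sub, Polynomial.aeval_X, Polynomial.aeval_C]
    field_simp
  rw [this]
  exact (hz.zpow hz' _).mul ((hasValue_aeval p').mul ((hasValue_aeval q').inv hq2))

theorem hasValue_coord (he : e ^ 2 = 1)
    (hw : w = (z - algebraMap ℂ RatZ e) / (z + algebraMap ℂ RatZ e)) : HasValue e w 0 := by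
  obtain ⟨hz, hz'⟩ := hasValue_z_add he
  have h := (hasValue_aeval (e := e) (Polynomial.X - Polynomial.C e)).mul (hz.inv hz')
  simpa [hw, div_eq_mul_inv] using h

/-- A differential-reflection operator lowers the order of vanishing at `z = ± 1` by a bounded
amount. -/
theorem exists_order_bound (he : e ^ 2 = 1)
    (hw : w = (z - algebraMap ℂ RatZ e) / (z + algebraMap ℂ RatZ e)) (hr : refl w = -w)
    (heu : euler w = (1 - w ^ 2) / 2) {S : Op} (hS : S ∈ diffRefl) :
    ∃ d : ℤ, ∀ (n : ℤ), ∀ x ∈ regular e, w ^ (-(n + d)) * S (w ^ n * x) ∈ regular e := by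
  have hw0 : w ≠ 0 := by
    rw [hw]
    exact div_ne_zero (z_sub_C_ne_zero e) (z_add_C_ne_zero e)
  have hwr : w ∈ regular e := (hasValue_coord he hw).mem_regular
  have mono : ∀ {m m' : ℤ} {x : RatZ}, m' ≤ m → w ^ (-m) * x ∈ regular e →
      w ^ (-m') * x ∈ regular e := by
    intro m m' x hm hx
    have h : w ^ (-m') * x = w ^ (m - m').toNat * (w ^ (-m) * x) := by
      rw [← zpow_natCast, Int.toNat_of_nonneg (by omega), ← mul_assoc, ← zpow_add₀ hw0]
      congr 2
      ring
    rw [h]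
    exact mul_mem (pow_mem hwr _) hx
  let M : Submodule ℂ Op :=
    { carrier := {S | ∃ d : ℤ, ∀ (n : ℤ), ∀ x ∈ regular e,
        w ^ (-(n + d)) * S (w ^ n * x) ∈ regular e}
      zero_mem' := ⟨0, fun n x _ => by simp [(regular e).zero_mem]⟩
      add_mem' := by
        rintro S T ⟨d, hS⟩ ⟨d', hT⟩
        refine ⟨min d d', fun n x hx => ?_⟩
        rw [LinearMap.add_apply, mul_add]
        exact add_mem (mono (by simp) (hS n x hx)) (mono (by simp) (hT n x hx))
      smul_mem' := by
        rintro c S ⟨d, hS⟩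
        refine ⟨d, fun n x hx => ?_⟩
        rw [LinearMap.smul_apply, mul_smul_comm]
        exact (regular e).smul_mem (hS n x hx) c }
  refine adjoin_mem_of_mul_mem M ⟨0, fun n x hx => ?_⟩ ?_ hS
  · rwa [add_zero, Module.End.one_apply, ← mul_assoc, ← zpow_add₀ hw0, neg_add_cancel, zpow_zero,
      one_mul]
  · rintro T hT S ⟨d, hS⟩
    -- rewrite the value of `S` as a power of `w` times a regular function
    have key : ∀ n x, S (w ^ n * x) = w ^ (n + d) * (w ^ (-(n + d)) * S (w ^ n * x)) := by
      intro n x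
      rw [← mul_assoc, ← zpow_add₀ hw0, add_neg_cancel, zpow_zero, one_mul]
    rcases hT with ⟨a, -, rfl⟩ | rfl | rfl
    · by_cases ha : a = 0
      · refine ⟨0, fun n x hx => ?_⟩
        rw [Module.End.mul_apply, mulOp_apply, ha, zero_mul, mul_zero]
        exact zero_mem _
      obtain ⟨m, c, -, hm⟩ := exists_leading he hw ha
      refine ⟨d + m, fun n x hx => ?_⟩
      have h : w ^ (-(n + (d + m))) * (mulOp a * S) (w ^ n * x)
          = (w ^ (-m) * a) * (w ^ (-(n + d)) * S (w ^ n * x)) := by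
        rw [Module.End.mul_apply, mulOp_apply, show -(n + (d + m)) = -m + -(n + d) by ring,
          zpow_add₀ hw0]
        ring
      rw [h]
      exact mul_mem hm.mem_regular (hS n x hx)
    · refine ⟨d - 1, fun n x hx => ?_⟩
      have hy := hS n x hx
      rw [Module.End.mul_apply, key n x]
      generalize w ^ (-(n + d)) * S (w ^ n * x) = y at hy
      have h : w ^ (-(n + (d - 1))) * theta (w ^ (n + d) * y)
          = algebraMap ℂ RatZ (1 / 2) * ((n + d : ℤ) * (1 - w ^ 2) * y) + w * euler y := by
        rw [theta_apply, euler_mul, euler_zpow, heu, zpow_sub_one₀ hw0,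
          show -(n + (d - 1)) = -(n + d) + 1 by ring, zpow_add_one₀ hw0, zpow_neg]
        have := zpow_ne_zero (n + d) hw0
        rw [map_div₀, map_one, map_ofNat]
        field_simp
        ring
      rw [h]
      exact add_mem (mul_mem (C_mem_regular _) (mul_mem (mul_mem (intCast_mem_regular _)
        (sub_mem (one_mem _) (pow_mem hwr 2))) hy)) (mul_mem hwr (euler_mem_regular hy))
    · refine ⟨d, fun n x hx => ?_⟩
      have hy := hS n x hx
      rw [Module.End.mul_apply, key n x]
      generalize w ^ (-(n + d)) * S (w ^ n * x) = y at hy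
      have h : w ^ (-(n + d)) * s (w ^ (n + d) * y)
          = algebraMap ℂ RatZ ((-1) ^ (n + d)) * refl y := by
        rw [s_apply, map_mul, map_zpow₀ refl, hr, show -w = -1 * w by ring, mul_zpow, zpow_neg,
          map_zpow₀, map_neg, map_one]
        have := zpow_ne_zero (n + d) hw0
        field_simp
      rw [h]
      exact mul_mem (C_mem_regular _) (refl_mem_regular he hy)

/-- An operator that preserves the Laurent polynomials also preserves the regularity at `z = ± 1`
of the nonnegative powers of the local coordinate, because these are Laurent polynomials up to
functions that vanish to an arbitrarily high order. -/
theorem map_coord_pow_mem_regular (he : e ^ 2 = 1)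
    (hw : w = (z - algebraMap ℂ RatZ e) / (z + algebraMap ℂ RatZ e)) (hr : refl w = -w)
    (heu : euler w = (1 - w ^ 2) / 2) {S : Op} (hS : S ∈ diffRefl)
    (hSl : ∀ f ∈ laurent, S f ∈ laurent) {j : ℤ} (hj : 0 ≤ j) : S (w ^ j) ∈ regular e := by
  have he0 : e ≠ 0 := by rintro rfl; simp at he
  have hwr : w ∈ regular e := (hasValue_coord he hw).mem_regular
  have hw0 : w ≠ 0 := by
    rw [hw]
    exact div_ne_zero (z_sub_C_ne_zero e) (z_add_C_ne_zero e)
  obtain ⟨d, hd⟩ := exists_order_bound he hw hr heu hS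
  have hwj : w ^ j ∈ regular e := by
    rw [← Int.toNat_of_nonneg hj, zpow_natCast]
    exact pow_mem hwr _
  obtain ⟨f, y, hy, hf⟩ := exists_polynomial_approx hwj (-d).toNat
  have h1 : (z - algebraMap ℂ RatZ e) ^ (-d).toNat * y
      = w ^ ((-d).toNat : ℤ) * ((z + algebraMap ℂ RatZ e) ^ (-d).toNat * y) := by
    have h2 := z_add_C_ne_zero e
    rw [hw, zpow_natCast, div_pow]
    field_simp
  have h2 : (z + algebraMap ℂ RatZ e) ^ (-d).toNat * y ∈ regular e :=
    mul_mem (pow_mem (hasValue_z_add he).1.mem_regular _) hy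
  have h3 := hd (-d).toNat _ h2
  have h4 : ∀ x : RatZ, x = w ^ (((-d).toNat : ℤ) + d).toNat
      * (w ^ (-(((-d).toNat : ℤ) + d)) * x) := by
    intro x
    rw [← zpow_natCast, Int.toNat_of_nonneg (by omega), ← mul_assoc, ← zpow_add₀ hw0,
      add_neg_cancel, zpow_zero, one_mul]
  rw [hf, map_add, h1, h4 (S (w ^ _ * _))]
  refine add_mem (laurent_le_regular he0 (hSl _ ?_)) (mul_mem (pow_mem hwr _) h3)
  exact Algebra.adjoin_le (Set.singleton_subset_iff.2 z_mem_laurent)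
    (Polynomial.aeval_mem_adjoin_singleton ℂ _)

/-! ### Leading coefficients at `z = ± 1` -/

/-- Polynomials with coefficients in `ℂ(z)`, not all zero, have leading coefficients at `z = ± 1`
after multiplication with a common power of the local coordinate. -/
theorem exists_leading_polynomials (he : e ^ 2 = 1)
    (hw : w = (z - algebraMap ℂ RatZ e) / (z + algebraMap ℂ RatZ e)) {P Q : RatZ[X]}
    (hPQ : P ≠ 0 ∨ Q ≠ 0) : ∃ d : ℤ, ∃ p q : ℂ[X], (p ≠ 0 ∨ q ≠ 0) ∧
      (∀ m, HasValue e (w ^ (-d) * P.coeff m) (p.coeff m)) ∧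
      (∀ m, HasValue e (w ^ (-d) * Q.coeff m) (q.coeff m)) := by
  classical
  have hwr : w ∈ regular e := (hasValue_coord he hw).mem_regular
  have hw0 : w ≠ 0 := by
    rw [hw]
    exact div_ne_zero (z_sub_C_ne_zero e) (z_add_C_ne_zero e)
  have hlead : ∀ x : RatZ, ∃ n : ℤ, x ≠ 0 → ∃ c : ℂ, c ≠ 0 ∧ HasValue e (w ^ (-n) * x) c := by
    intro x
    by_cases hx : x = 0
    · exact ⟨0, fun h => absurd hx h⟩
    · obtain ⟨n, h⟩ := exists_leading he hw hx
      exact ⟨n, fun _ => h⟩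
  choose v hv using hlead
  have hne : (P.coeffs ∪ Q.coeffs).Nonempty := by
    rw [Finset.union_nonempty, Polynomial.coeffs_nonempty_iff, Polynomial.coeffs_nonempty_iff]
    exact hPQ
  obtain ⟨x₀, hx₀, hmin⟩ := Finset.exists_min_image _ v hne
  have hreg : ∀ x : RatZ, (x ≠ 0 → v x₀ ≤ v x) → w ^ (-v x₀) * x ∈ regular e := by
    intro x hx
    by_cases hx0 : x = 0
    · rw [hx0, mul_zero]
      exact zero_mem _
    · obtain ⟨c, -, hc⟩ := hv x hx0
      have h : w ^ (-v x₀) * x = w ^ (v x - v x₀).toNat * (w ^ (-v x) * x) := by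
        rw [← zpow_natCast, Int.toNat_of_nonneg (by have := hx hx0; omega), ← mul_assoc,
          ← zpow_add₀ hw0]
        congr 2
        ring
      rw [h]
      exact mul_mem (pow_mem hwr _) hc.mem_regular
  have hpoly : ∀ R : RatZ[X], (∀ m, R.coeff m ≠ 0 → v x₀ ≤ v (R.coeff m)) →
      ∃ r : ℂ[X], ∀ m, HasValue e (w ^ (-v x₀) * R.coeff m) (r.coeff m) := by
    intro R hR
    choose c hc using fun m => hreg (R.coeff m) (hR m)
    refine ⟨∑ m ∈ R.support, Polynomial.monomial m (c m), fun m => ?_⟩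
    rw [Polynomial.finsetSum_coeff]
    simp only [Polynomial.coeff_monomial]
    rw [Finset.sum_ite_eq']
    split_ifs with hm
    · exact hc m
    · rw [Polynomial.notMem_support_iff.1 hm, mul_zero]
      simpa using hasValue_C (e := e) 0
  obtain ⟨p, hp⟩ := hpoly P fun m hm =>
    hmin _ (Finset.mem_union_left _ (Polynomial.coeff_mem_coeffs hm))
  obtain ⟨q, hq⟩ := hpoly Q fun m hm =>
    hmin _ (Finset.mem_union_right _ (Polynomial.coeff_mem_coeffs hm))
  refine ⟨v x₀, p, q, ?_, hp, hq⟩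
  rcases Finset.mem_union.1 hx₀ with h | h
  · left
    rintro rfl
    obtain ⟨m, hm, rfl⟩ := Polynomial.mem_coeffs_iff.1 h
    obtain ⟨c, hc, hc'⟩ := hv _ (Polynomial.mem_support_iff.1 hm)
    exact hc (hc'.unique (hp m))
  · right
    rintro rfl
    obtain ⟨m, hm, rfl⟩ := Polynomial.mem_coeffs_iff.1 h
    obtain ⟨c, hc, hc'⟩ := hv _ (Polynomial.mem_support_iff.1 hm)
    exact hc (hc'.unique (hq m))

theorem HasValue.sum {ι : Type*} (S : Finset ι) {f : ι → RatZ} {g : ι → ℂ}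
    (h : ∀ i, HasValue e (f i) (g i)) : HasValue e (∑ i ∈ S, f i) (∑ i ∈ S, g i) := by
  classical
  induction S using Finset.induction_on with
  | empty => simpa using hasValue_C (e := e) 0
  | insert i S hi ih =>
    rw [Finset.sum_insert hi, Finset.sum_insert hi]
    exact (h i).add ih

theorem hasValue_eval {x : RatZ} {P : RatZ[X]} {p : ℂ[X]}
    (h : ∀ m, HasValue e (x * P.coeff m) (p.coeff m)) (j : ℤ) :
    HasValue e (x * P.eval (j : RatZ)) (p.eval (j : ℂ)) := by
  have hj : HasValue e (j : RatZ) (j : ℂ) := by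
    rw [← map_intCast (algebraMap ℂ RatZ)]
    exact hasValue_C _
  rw [Polynomial.eval_eq_sum_range' (n := P.natDegree + p.natDegree + 1) (by omega),
    Polynomial.eval_eq_sum_range' (n := P.natDegree + p.natDegree + 1) (by omega), Finset.mul_sum]
  refine HasValue.sum _ fun m => ?_
  rw [← mul_assoc]
  exact (h m).mul (hj.pow m)

/-- The leading coefficients `c j` at `z = ± 1` of the functions `S (w ^ j)` satisfy the relation
for an operator of degree `d` that intertwines the rank one Dunkl operators with the parameters `κ₀`
and `κ₀'`. -/
theorem leading_recursion (he : e ^ 2 = 1)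
    (hw : w = (z - algebraMap ℂ RatZ e) / (z + algebraMap ℂ RatZ e)) (hr : refl w = -w)
    (heu : euler w = (1 - w ^ 2) / 2) {κ₀ κ₁ ρ κ₀' κ₁' ρ' : ℂ} {D D' S : Op}
    (hD : ∀ f, D f = euler f + (algebraMap ℂ RatZ κ₀ * w⁻¹ + algebraMap ℂ RatZ κ₁ * w) / 2
      * (f - refl f) - algebraMap ℂ RatZ ρ * refl f)
    (hD' : ∀ f, D' f = euler f + (algebraMap ℂ RatZ κ₀' * w⁻¹ + algebraMap ℂ RatZ κ₁' * w) / 2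
      * (f - refl f) - algebraMap ℂ RatZ ρ' * refl f)
    (hS : S * D = D' * S) {Φ : ℤ → RatZ} (hΦ : ∀ j, S (w ^ j) = Φ j * w ^ j) {d : ℤ} {c : ℤ → ℂ}
    (hc : ∀ j, HasValue e (w ^ (-d) * Φ j) (c j)) (j : ℤ) {ε δ : ℂ} (hε : (-1) ^ j = ε)
    (hδ : (-1) ^ d = δ) :
    (j + κ₀ * (1 - ε)) * c (j - 1) = (j + d + κ₀' * (1 - ε * δ)) * c j := by
  have hw0 : w ≠ 0 := by
    rw [hw]
    exact div_ne_zero (z_sub_C_ne_zero e) (z_add_C_ne_zero e)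
  have hwv := hasValue_coord he hw
  have hwr : w ∈ regular e := hwv.mem_regular
  have key := intertwine_zpow hw0 hr heu hD hD' hS hΦ j hε
  have hy : ∀ j, Φ j = w ^ d * (w ^ (-d) * Φ j) := fun j => by
    rw [← mul_assoc, ← zpow_add₀ hw0, add_neg_cancel, zpow_zero, one_mul]
  generalize hY : (fun j => w ^ (-d) * Φ j) = Y
  have hY' : ∀ j, w ^ (-d) * Φ j = Y j := fun j => congrFun hY j
  simp only [hY'] at hc hy
  have hYr : ∀ j, Y j ∈ regular e := fun j => (hc j).mem_regular
  have hrw : refl (w ^ d) = algebraMap ℂ RatZ δ * w ^ d := by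
    rw [map_zpow₀, hr, show -w = -1 * w by ring, mul_zpow, ← hδ, map_zpow₀, map_neg, map_one]
  have hew : euler (w ^ d) = d * w ^ d * ((w⁻¹ - w) / 2) := by
    rw [euler_zpow, heu, zpow_sub_one₀ hw0]
    field_simp
  rw [hy j, hy (j - 1), hy (j + 1), euler_mul, hew, map_mul refl, hrw] at key
  have hwd : w ^ d ≠ 0 := zpow_ne_zero d hw0
  set Z : RatZ := -(algebraMap ℂ RatZ (-j + κ₁ * (1 - ε)) * w * Y (j + 1))
    + algebraMap ℂ RatZ (2 * ρ * ε) * Y j + algebraMap ℂ RatZ 2 * euler (Y j)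
    - algebraMap ℂ RatZ (j + d) * w * Y j
    + algebraMap ℂ RatZ κ₁' * w * (Y j - algebraMap ℂ RatZ (ε * δ) * refl (Y j))
    - algebraMap ℂ RatZ (2 * ρ' * ε * δ) * refl (Y j) with hZ
  have hZr : Z ∈ regular e := by
    have hR := refl_mem_regular he (hYr j)
    have hE := euler_mem_regular (hYr j)
    exact sub_mem (add_mem (sub_mem (add_mem (add_mem
      (neg_mem (mul_mem (mul_mem (C_mem_regular _) hwr) (hYr _)))
      (mul_mem (C_mem_regular _) (hYr _))) (mul_mem (C_mem_regular _) hE))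
      (mul_mem (mul_mem (C_mem_regular _) hwr) (hYr _)))
      (mul_mem (mul_mem (C_mem_regular _) hwr) (sub_mem (hYr _) (mul_mem (C_mem_regular _) hR))))
      (mul_mem (C_mem_regular _) hR)
  have hmain : algebraMap ℂ RatZ (j + κ₀ * (1 - ε)) * Y (j - 1)
      = algebraMap ℂ RatZ (j + d + κ₀') * Y j
        + algebraMap ℂ RatZ (-(κ₀' * (ε * δ))) * refl (Y j) + w * Z := by
    refine mul_left_cancel₀ hwd ?_
    rw [hZ]
    have h1 : w * w⁻¹ = 1 := mul_inv_cancel₀ hw0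
    generalize w⁻¹ = v at h1 key
    simp only [map_add, map_mul, map_sub, map_one, map_neg, map_ofNat, map_intCast] at key ⊢
    linear_combination w * key - w ^ d * ((j + algebraMap ℂ RatZ κ₀ * (1 - algebraMap ℂ RatZ ε))
      * Y (j - 1) - (j + d) * Y j - algebraMap ℂ RatZ κ₀' * (Y j - algebraMap ℂ RatZ ε
      * algebraMap ℂ RatZ δ * refl (Y j))) * h1
  obtain ⟨ζ, hζ⟩ := hZr
  have e1 := (hasValue_C (e := e) (j + κ₀ * (1 - ε))).mul (hc (j - 1))
  rw [hmain] at e1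
  have e2 := (((hasValue_C (e := e) (j + d + κ₀')).mul (hc j)).add
    ((hasValue_C (e := e) (-(κ₀' * (ε * δ)))).mul ((hc j).refl he))).add (hwv.mul hζ)
  have e3 := e1.unique e2
  linear_combination e3

end LocalCoordinate

/-! ### The order of a shift operator -/

/-- The degree of polynomial solutions of the recursion for the leading coefficients, found by
comparison of the two highest coefficients. -/
theorem natDegree_of_recursion {p q : ℂ[X]} (hpq : p ≠ 0 ∨ q ≠ 0) {α β γ : ℂ}
    (h1 : Polynomial.X * Polynomial.taylor (-1) q = (Polynomial.X + Polynomial.C α) * p)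
    (h2 : (Polynomial.X + Polynomial.C β) * Polynomial.taylor (-1) p
      = (Polynomial.X + Polynomial.C γ) * q) :
    p ≠ 0 ∧ q ≠ 0 ∧ q.natDegree = p.natDegree ∧ 2 * (p.natDegree : ℂ) = β - α - γ := by
  have hX : ∀ c : ℂ, (Polynomial.X + Polynomial.C c : ℂ[X]) ≠ 0 := Polynomial.X_add_C_ne_zero
  have ht : ∀ f : ℂ[X], Polynomial.taylor (-1) f = 0 → f = 0 := fun f hf =>
    Polynomial.taylor_injective (-1) (by rw [hf, map_zero])
  have hp : p ≠ 0 := by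
    rintro rfl
    rw [mul_zero] at h1
    exact hpq.elim (fun h => h rfl) fun h =>
      h (ht q ((mul_eq_zero.1 h1).resolve_left Polynomial.X_ne_zero))
  have hq : q ≠ 0 := by
    rintro rfl
    rw [mul_zero] at h2
    exact hp (ht p ((mul_eq_zero.1 h2).resolve_left (hX β)))
  have hdeg : q.natDegree = p.natDegree := by
    have h := congrArg Polynomial.natDegree h1
    rw [Polynomial.natDegree_mul Polynomial.X_ne_zero (fun h => hq (ht q h)),
      Polynomial.natDegree_mul (hX α) hp, Polynomial.natDegree_taylor, Polynomial.natDegree_X,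
      Polynomial.natDegree_X_add_C] at h
    omega
  refine ⟨hp, hq, hdeg, ?_⟩
  generalize hD : p.natDegree = D at hdeg ⊢
  have hp' : ∀ m, D < m → p.coeff m = 0 := fun m hm =>
    Polynomial.coeff_eq_zero_of_natDegree_lt (by omega)
  have hq' : ∀ m, D < m → q.coeff m = 0 := fun m hm =>
    Polynomial.coeff_eq_zero_of_natDegree_lt (by omega)
  rw [add_mul] at h1 h2
  rw [add_mul] at h2
  have e1 := congrArg (fun f : ℂ[X] => f.coeff (D + 1)) h1
  have e2 := congrArg (fun f : ℂ[X] => f.coeff D) h1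
  have e3 := congrArg (fun f : ℂ[X] => f.coeff D) h2
  simp only [Polynomial.coeff_add, Polynomial.coeff_X_mul, Polynomial.coeff_C_mul,
    coeff_taylor_of_lt hq', hp' (D + 1) (by omega), mul_zero, add_zero] at e1
  simp only [Polynomial.coeff_add, Polynomial.coeff_C_mul, coeff_X_mul_taylor hq'] at e2
  simp only [Polynomial.coeff_add, Polynomial.coeff_C_mul, coeff_X_mul_taylor hp',
    coeff_taylor_of_lt hp'] at e3
  rw [e1] at e2 e3
  have hlc : p.coeff D ≠ 0 := by
    rw [← hD]
    exact Polynomial.leadingCoeff_ne_zero.2 hp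
  refine mul_right_cancel₀ hlc ?_
  linear_combination -e2 - e3

/-- The local estimate. Let `S` intertwine two operators that near the zero of the coordinate `w`
are, up to a factor, rank one Dunkl operators with the parameters `κ₀` and `κ₀ + n`. If the order of
`S` were smaller than `|n|`, then the leading coefficients of the functions `S (w ^ j)` would vanish
for too many `j ≥ 0`: for `n > 0` because `S` preserves regularity, and for `n < 0` because the
recursion for the leading coefficients starts at `0` and meets no resonance. -/
theorem natAbs_le_order {e : ℂ} {w : RatZ} (he : e ^ 2 = 1)
    (hw : w = (z - algebraMap ℂ RatZ e) / (z + algebraMap ℂ RatZ e)) (hr : refl w = -w)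
    (heu : euler w = (1 - w ^ 2) / 2) {κ₀ κ₁ ρ κ₀' κ₁' ρ' : ℂ} {D D' S : Op}
    (hD : ∀ f, D f = euler f + (algebraMap ℂ RatZ κ₀ * w⁻¹ + algebraMap ℂ RatZ κ₁ * w) / 2
      * (f - refl f) - algebraMap ℂ RatZ ρ * refl f)
    (hD' : ∀ f, D' f = euler f + (algebraMap ℂ RatZ κ₀' * w⁻¹ + algebraMap ℂ RatZ κ₁' * w) / 2
      * (f - refl f) - algebraMap ℂ RatZ ρ' * refl f)
    (hS : S * D = D' * S) (hSd : S ∈ diffRefl) (hSl : ∀ f ∈ laurent, S f ∈ laurent)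
    {n : ℤ} (hn : κ₀' = κ₀ + n) (hres : n < 0 → ∀ m : ℕ, κ₀ ≠ m + 1 / 2) {P Q : RatZ[X]} {N : ℕ}
    (hP : P.natDegree ≤ N) (hPQ : P ≠ 0 ∨ Q ≠ 0)
    (heven : ∀ j : ℤ, Even j → S (w ^ j) = P.eval (j : RatZ) * w ^ j)
    (hodd : ∀ j : ℤ, Odd j → S (w ^ j) = Q.eval (j : RatZ) * w ^ j) : n.natAbs ≤ N := by
  have hw0 : w ≠ 0 := by
    rw [hw]
    exact div_ne_zero (z_sub_C_ne_zero e) (z_add_C_ne_zero e)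
  obtain ⟨d, p, q, hpq, hp, hq⟩ := exists_leading_polynomials he hw hPQ
  have hdeg : ∀ {R : RatZ[X]} {r : ℂ[X]}, R.natDegree ≤ N →
      (∀ m, HasValue e (w ^ (-d) * R.coeff m) (r.coeff m)) → r.natDegree ≤ N := by
    intro R r hR hr
    rw [Polynomial.natDegree_le_iff_coeff_eq_zero]
    intro m hm
    have h := hr m
    rw [Polynomial.coeff_eq_zero_of_natDegree_lt (lt_of_le_of_lt hR hm), mul_zero] at h
    exact h.unique (by simpa using hasValue_C (e := e) 0)
  let Φ : ℤ → RatZ := fun j => if Even j then P.eval (j : RatZ) else Q.eval (j : RatZ)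
  let c : ℤ → ℂ := fun j => if Even j then p.eval (j : ℂ) else q.eval (j : ℂ)
  have hΦ : ∀ j, S (w ^ j) = Φ j * w ^ j := by
    intro j
    by_cases hj : Even j
    · simp only [Φ, if_pos hj, heven j hj]
    · simp only [Φ, if_neg hj, hodd j (Int.not_even_iff_odd.1 hj)]
  have hc : ∀ j, HasValue e (w ^ (-d) * Φ j) (c j) := by
    intro j
    by_cases hj : Even j
    · simp only [Φ, c, if_pos hj]
      exact hasValue_eval hp j
    · simp only [Φ, c, if_neg hj]
      exact hasValue_eval hq j
  generalize hδ : (-1 : ℂ) ^ d = δ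
  have hrec := fun j ε (hε : (-1 : ℂ) ^ j = ε) =>
    leading_recursion he hw hr heu hD hD' hS hΦ hc j hε hδ
  have h1 : Polynomial.X * Polynomial.taylor (-1) q
      = (Polynomial.X + Polynomial.C (d + κ₀' * (1 - δ))) * p := by
    rw [← sub_eq_zero]
    refine eq_zero_of_eval_even fun j hj => ?_
    have h := hrec j 1 hj.neg_one_zpow
    simp only [c, if_pos hj, if_neg (Int.not_even_iff_odd.2 (hj.sub_odd odd_one))] at h
    simp only [Polynomial.eval_sub, Polynomial.eval_mul, Polynomial.eval_add, Polynomial.eval_X,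
      Polynomial.eval_C, Polynomial.taylor_eval]
    push_cast at h
    rw [sub_eq_add_neg (j : ℂ) 1] at h
    linear_combination h
  have h2 : (Polynomial.X + Polynomial.C (2 * κ₀)) * Polynomial.taylor (-1) p
      = (Polynomial.X + Polynomial.C (d + κ₀' * (1 + δ))) * q := by
    rw [← sub_eq_zero]
    refine eq_zero_of_eval_odd fun j hj => ?_
    have h := hrec j (-1) hj.neg_one_zpow
    simp only [c, if_neg (Int.not_even_iff_odd.2 hj), if_pos (hj.sub_odd odd_one)] at h
    simp only [Polynomial.eval_sub, Polynomial.eval_mul, Polynomial.eval_add, Polynomial.eval_X,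
      Polynomial.eval_C, Polynomial.taylor_eval]
    push_cast at h
    rw [sub_eq_add_neg (j : ℂ) 1] at h
    linear_combination h
  obtain ⟨hp0, -, -, hdim⟩ := natDegree_of_recursion hpq h1 h2
  have hDN := hdeg hP hp
  generalize hD₀ : p.natDegree = M at hdim hDN
  have hM : (M : ℤ) = -d - n := by
    have : ((M : ℤ) : ℂ) = ((-d - n : ℤ) : ℂ) := by
      push_cast
      linear_combination (1 / 2 : ℂ) * hdim - hn
    exact_mod_cast this
  by_contra hlt
  -- the leading coefficients vanish at `0, 2, …, 2 M`, more often than the degree `M` permits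
  have hzero : ∀ i : ℕ, i ≤ M → p.eval ((2 * i : ℤ) : ℂ) = 0 := by
    intro i hi
    have hci : c (2 * i) = p.eval ((2 * i : ℤ) : ℂ) := if_pos (even_two_mul _)
    rw [← hci]
    rcases lt_or_ge n 0 with hneg | hnn
    · have hne : ∀ m : ℤ, 0 < m → m < -2 * n → (m : ℂ) + κ₀' * (1 - (-1) ^ m) ≠ 0 := by
        intro m hm hm'
        rcases Int.even_or_odd m with h | h
        · rw [h.neg_one_zpow, sub_self, mul_zero, add_zero]
          exact_mod_cast hm.ne'
        · rw [h.neg_one_zpow]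
          intro h0
          obtain ⟨a, ha⟩ := h
          refine hres hneg (-n - a - 1).toNat ?_
          have h1 : (((-n - a - 1).toNat : ℤ) : ℂ) = ((-n - a - 1 : ℤ) : ℂ) := by
            rw [Int.toNat_of_nonneg (by omega)]
          rw [Int.cast_natCast] at h1
          have ha' : (m : ℂ) = 2 * a + 1 := by exact_mod_cast ha
          rw [h1]
          push_cast
          linear_combination (1 / 2 : ℂ) * h0 - hn - 1 / 2 * ha'
      have key : ∀ j : ℕ, (j : ℤ) < M - n → c j = 0 := by
        intro j
        induction j using Nat.strong_induction_on with
        | h j ih =>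
        intro hj
        have h := hrec j _ rfl
        rw [← hδ, ← zpow_add₀ (by norm_num : (-1 : ℂ) ≠ 0)] at h
        have h' := hne (j + d) (by omega) (by omega)
        rw [Int.cast_add] at h'
        refine (mul_eq_zero.1 (h.symm.trans ?_)).resolve_left h'
        cases j with
        | zero => simp
        | succ j =>
          rw [show ((j + 1 : ℕ) : ℤ) - 1 = j by push_cast; ring,
            ih j (by omega) (by push_cast at hj; omega), mul_zero]
      exact_mod_cast key (2 * i) (by push_cast; omega)
    · have hreg := map_coord_pow_mem_regular he hw hr heu hSd hSl (j := 2 * i) (by omega)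
      rw [hΦ] at hreg
      obtain ⟨a, ha⟩ := hreg
      have h3 : w ^ (-d) * Φ (2 * i)
          = w ^ (-d - 2 * i - 1).toNat * (w * (Φ (2 * i) * w ^ (2 * i : ℤ))) := by
        rw [← zpow_natCast, Int.toNat_of_nonneg (by omega), zpow_sub₀ hw0, zpow_sub₀ hw0, zpow_one]
        have := zpow_ne_zero (2 * i : ℤ) hw0
        field_simp
      have h4 := hc (2 * i)
      rw [h3] at h4
      have h5 := ((hasValue_coord he hw).pow (-d - 2 * i - 1).toNat).mul
        ((hasValue_coord he hw).mul ha)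
      rw [h4.unique h5, zero_mul, mul_zero]
  refine hp0 (Polynomial.eq_zero_of_natDegree_lt_card_of_eval_eq_zero p
    (f := fun i : Fin (M + 1) => ((2 * (i : ℕ) : ℤ) : ℂ)) ?_ ?_ ?_)
  · intro a b hab
    have := Int.cast_injective hab
    exact Fin.ext (by omega)
  · exact fun i => hzero i (by omega)
  · rw [Fintype.card_fin]
    omega

theorem t_eq : t = (z - algebraMap ℂ RatZ 1) / (z + algebraMap ℂ RatZ 1) := by
  rw [map_one, t]

theorem t_inv_eq : t⁻¹ = (z - algebraMap ℂ RatZ (-1)) / (z + algebraMap ℂ RatZ (-1)) := by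
  rw [map_neg, map_one, t, inv_div, sub_neg_eq_add, ← sub_eq_add_neg]

/-- The order of a nonzero shift operator is bounded below by the local estimates at `z = 1` and at
`z = -1`. -/
theorem order_lower_bound {l : ℤ × ℤ} {k : ℂ × ℂ}
    (h1 : l.1 + l.2 < 0 → ∀ n : ℕ, k.1 + k.2 ≠ (n : ℂ) + 1 / 2)
    (h2 : l.2 < 0 → ∀ n : ℕ, k.2 ≠ (n : ℂ) + 1 / 2) {A B : RatZ[X]}
    (hS : opOf₂ A B ∈ shiftOps l k) (hS0 : opOf₂ A B ≠ 0) {N : ℕ}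
    (hA : ∀ m, N < m → A.coeff m = 0) (hB : ∀ m, N < m → B.coeff m = 0) :
    (l.1 + l.2).natAbs ≤ N ∧ l.2.natAbs ≤ N := by
  have hP : (A + B).natDegree ≤ N := Polynomial.natDegree_le_iff_coeff_eq_zero.2 fun m hm => by
    rw [Polynomial.coeff_add, hA m hm, hB m hm, add_zero]
  have hPQ : A + B ≠ 0 ∨ A - B ≠ 0 := by
    by_contra! h
    obtain ⟨ha, hb⟩ := h
    have hA0 : A = 0 := by
      have : 2 * A = 0 := by linear_combination ha + hb
      exact (mul_eq_zero.1 this).resolve_left two_ne_zero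
    rw [hA0, zero_add] at ha
    exact hS0 (by rw [hA0, ha, opOf₂, opOf_zero, zero_mul, add_zero])
  obtain ⟨hSd, hSi, hSl⟩ := hS
  constructor
  · exact natAbs_le_order (e := 1) (by norm_num) t_eq refl_t euler_t (cherednik_apply_coord k)
      (cherednik_apply_coord (shift k l)) hSi hSd hSl
      (by simp only [shift]; push_cast; ring) h1 hP hPQ
      (fun j hj => opOf₂_zpow_even A B hj) (fun j hj => opOf₂_zpow_odd A B hj)
  · have hne : ∀ P : RatZ[X], P ≠ 0 → P.comp (-Polynomial.X) ≠ 0 := fun P hP h => hP (by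
      simpa using congr(Polynomial.comp $h (-Polynomial.X)))
    refine natAbs_le_order (e := -1) (by norm_num) t_inv_eq refl_t_inv euler_t_inv
      (cherednik_apply_coord_inv k) (cherednik_apply_coord_inv (shift k l)) hSi hSd hSl
      (by simp only [shift]) h2 (P := (A + B).comp (-Polynomial.X))
      (Q := (A - B).comp (-Polynomial.X)) ?_ (hPQ.imp (hne _) (hne _)) (fun j hj => ?_)
      (fun j hj => ?_)
    · rwa [Polynomial.natDegree_comp, Polynomial.natDegree_neg, Polynomial.natDegree_X, mul_one]
    · rw [inv_zpow', opOf₂_zpow_even A B hj.neg, Polynomial.eval_comp]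
      simp
    · rw [inv_zpow', opOf₂_zpow_odd A B hj.neg, Polynomial.eval_comp]
      simp

/-! ### The symbol of the generator -/

/-- Products of `N` first-order operators `a θ + b + c s` with `a ≠ 0`. -/
inductive IsFirstOrderProduct : ℕ → Op → Prop
  | one : IsFirstOrderProduct 0 1
  | mul {N : ℕ} {T : Op} (a b c : RatZ) (ha : a ≠ 0) (hT : IsFirstOrderProduct N T) :
      IsFirstOrderProduct (N + 1) ((mulOp a * theta + mulOp b + mulOp c * s) * T)

theorem IsFirstOrderProduct.comp {M N : ℕ} {S T : Op} (hS : IsFirstOrderProduct M S)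
    (hT : IsFirstOrderProduct N T) : IsFirstOrderProduct (N + M) (S * T) := by
  induction hS with
  | one => rwa [one_mul]
  | mul a b c ha _ ih =>
    rw [mul_assoc, ← add_assoc]
    exact ih.mul a b c ha

theorem IsFirstOrderProduct.pow {T : Op} (hT : IsFirstOrderProduct 1 T) (j : ℕ) :
    IsFirstOrderProduct j (T ^ j) := by
  induction j with
  | zero => exact pow_zero T ▸ .one
  | succ j ih => exact pow_succ' T j ▸ hT.comp ih

theorem IsFirstOrderProduct.hasSymbol {N : ℕ} {T : Op} (hT : IsFirstOrderProduct N T) :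
    ∃ p, p ≠ 0 ∧ HasSymbol T N p := by
  induction hT with
  | one => exact ⟨1, one_ne_zero, hasSymbol_one⟩
  | mul a b c ha _ ih =>
    obtain ⟨p, hp, h⟩ := ih
    exact ⟨_, mul_ne_zero (mul_ne_zero ha coordFactor_ne_zero) hp, h.firstOrder_mul a b c⟩

theorem isFirstOrderProduct_of_apply {T : Op} (a b c : RatZ) (ha : a ≠ 0)
    (hT : ∀ f, T f = a * euler f + b * f + c * refl f) : IsFirstOrderProduct 1 T := by
  have h : T = (mulOp a * theta + mulOp b + mulOp c * s) * 1 := by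
    ext f
    exact hT f
  rw [h]
  exact .mul a b c ha .one

theorem isFirstOrderProduct_cherednik (k : ℂ × ℂ) : IsFirstOrderProduct 1 (cherednik k) :=
  isFirstOrderProduct_of_apply _ _ _ one_ne_zero (cherednik_apply' k)

theorem isFirstOrderProduct_forward (k : ℂ × ℂ) : IsFirstOrderProduct 1 (forward k) :=
  isFirstOrderProduct_of_apply (z / ((z - 1) * (z + 1))) (-(z ^ 3 / ((z - 1) * (z + 1)) ^ 2))
    (z ^ 3 / ((z - 1) * (z + 1)) ^ 2)
    (div_ne_zero z_ne_zero (mul_ne_zero z_sub_one_ne_zero z_add_one_ne_zero))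
    fun f => by rw [forward_apply]; ring

theorem isFirstOrderProduct_backward (k : ℂ × ℂ) : IsFirstOrderProduct 1 (backward k) :=
  isFirstOrderProduct_of_apply ((z - 1) * (z + 1) / z)
    (algebraMap ℂ RatZ (k.1 + 2 * k.2 - 1) * (z + 1 / z) + algebraMap ℂ RatZ (2 * k.1) + 1 / z) (-z)
    (div_ne_zero (mul_ne_zero z_sub_one_ne_zero z_add_one_ne_zero) z_ne_zero)
    fun f => by rw [backward_apply]; ring

theorem isFirstOrderProduct_contigPlus (k : ℂ × ℂ) : IsFirstOrderProduct 1 (contigPlus k) :=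
  isFirstOrderProduct_of_apply ((z + 1) / (z - 1))
    (algebraMap ℂ RatZ (k.2 - 1 / 2) - z / (z - 1) ^ 2) (z / (z - 1) ^ 2)
    (div_ne_zero z_add_one_ne_zero z_sub_one_ne_zero)
    fun f => by rw [contigPlus_apply]; ring

theorem isFirstOrderProduct_contigMinus (k : ℂ × ℂ) : IsFirstOrderProduct 1 (contigMinus k) :=
  isFirstOrderProduct_of_apply ((z - 1) / (z + 1))
    (algebraMap ℂ RatZ (k.1 + k.2 - 1 / 2) + z / (z + 1) ^ 2) (-(z / (z + 1) ^ 2))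
    (div_ne_zero z_sub_one_ne_zero z_add_one_ne_zero)
    fun f => by rw [contigMinus_apply]; ring

theorem isFirstOrderProduct_chain {F : ℂ × ℂ → Op} (hF : ∀ k, IsFirstOrderProduct 1 (F k))
    (v : ℤ × ℤ) (N : ℕ) (k : ℂ × ℂ) : IsFirstOrderProduct N (chain F v N k) := by
  induction N with
  | zero => exact .one
  | succ N ih => exact (hF _).comp ih

theorem isFirstOrderProduct_signedChain {F G : ℂ × ℂ → Op} (hF : ∀ k, IsFirstOrderProduct 1 (F k))
    (hG : ∀ k, IsFirstOrderProduct 1 (G k)) (v : ℤ × ℤ) (n : ℤ) (k : ℂ × ℂ) :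
    IsFirstOrderProduct n.natAbs (signedChain F G v n k) := by
  rw [signedChain]
  split_ifs
  · exact isFirstOrderProduct_chain hF _ _ _
  · exact isFirstOrderProduct_chain hG _ _ _

theorem isFirstOrderProduct_gen {l : ℤ × ℤ} (hl : Even l.1) (k : ℂ × ℂ) :
    IsFirstOrderProduct (max (l.1 + l.2).natAbs l.2.natAbs) (gen l k) := by
  obtain ⟨m, n, rfl⟩ := exists_eq_of_even hl
  rw [gen_eq]
  have h := (isFirstOrderProduct_signedChain isFirstOrderProduct_contigPlus
    isFirstOrderProduct_contigMinus (2, -1) m (shift k (n • (0, 1)))).comp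
    (isFirstOrderProduct_signedChain isFirstOrderProduct_forward isFirstOrderProduct_backward
      (0, 1) n k)
  convert h using 1
  omega

theorem IsFirstOrderProduct.exists_mul_opOf₂ {N : ℕ} {T : Op} (hT : IsFirstOrderProduct N T)
    (A B : RatZ[X]) :
    ∃ A' B', T * opOf₂ A B = opOf₂ A' B' ∧ (opOf₂ A' B' = 0 → opOf₂ A B = 0) := by
  induction hT with
  | one => exact ⟨A, B, one_mul _, id⟩
  | mul a b c ha _ ih =>
    obtain ⟨A', B', h, h'⟩ := ih
    refine ⟨_, _, by rw [mul_assoc, h, firstOrder_mul_opOf₂], fun h0 => h' ?_⟩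
    rw [← firstOrder_mul_opOf₂] at h0
    exact eq_zero_of_firstOrder_mul_eq_zero ha h0

/-- A product of first-order operators can be cancelled on the left. -/
theorem IsFirstOrderProduct.eq_zero_of_mul_eq_zero {N : ℕ} {T S : Op}
    (hT : IsFirstOrderProduct N T) (hS : S ∈ diffRefl) (h : T * S = 0) : S = 0 := by
  obtain ⟨A, B, rfl⟩ := exists_opOf₂_eq hS
  obtain ⟨A', B', h', h0⟩ := hT.exists_mul_opOf₂ A B
  exact h0 (h' ▸ h)

/-! ### Shift operators are multiples of the generator -/

theorem mul_cherednik_pow {l : ℤ × ℤ} {k : ℂ × ℂ} {S : Op} (hS : S ∈ shiftOps l k) (j : ℕ) :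
    S * cherednik k ^ j = cherednik (shift k l) ^ j * S := by
  induction j with
  | zero => simp
  | succ j ih => rw [pow_succ, ← mul_assoc, ih, mul_assoc, hS.2.1, ← mul_assoc, ← pow_succ]

theorem aeval_cherednik_mem_shiftAlg (k : ℂ × ℂ) (q : ℂ[X]) :
    Polynomial.aeval (cherednik k) q ∈ shiftAlg k :=
  Algebra.adjoin_le (Set.singleton_subset_iff.2 (cherednik_mem_shiftAlg k))
    (Polynomial.aeval_mem_adjoin_singleton ℂ _)

theorem exists_eq_C_mul_of_euler {x y h : RatZ} (hx : 2 * euler x = h * x)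
    (hy : 2 * euler y = h * y) (hy0 : y ≠ 0) : ∃ c : ℂ, x = algebraMap ℂ RatZ c * y := by
  obtain ⟨c, hc⟩ := eq_C_of_euler_eq_zero (f := x / y) (by
    have h0 : y * euler x - x * euler y = 0 := by
      refine (mul_eq_zero.1 (?_ : (2 : RatZ) * _ = 0)).resolve_left two_ne_zero
      linear_combination y * hx - x * hy
    rw [euler_div, h0, mul_zero])
  exact ⟨c, by rw [← hc, div_mul_cancel₀ _ hy0]⟩

/-- If `G` is a shift operator of order `M` with nonvanishing symbol and no nonzero shift operator
with the same shift has a smaller order, then all of them are of the form `G q(D_k)`. Indeed the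
symbols of two shift operators of the same order are proportional, since they solve the same
differential equation, and hence a multiple of some `G D_k ^ j` can be subtracted to lower the
order. -/
theorem exists_eq_mul_aeval {l : ℤ × ℤ} {k : ℂ × ℂ} {G : Op} (hG : G ∈ shiftOps l k) {M : ℕ}
    (hGM : IsFirstOrderProduct M G)
    (hmin : ∀ (A B : RatZ[X]) (N : ℕ), opOf₂ A B ∈ shiftOps l k → opOf₂ A B ≠ 0 →
      (∀ m, N < m → A.coeff m = 0) → (∀ m, N < m → B.coeff m = 0) → M ≤ N)
    {S : Op} (hS : S ∈ shiftOps l k) :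
    ∃ q : ℂ[X], S = G * Polynomial.aeval (cherednik k) q := by
  suffices h : ∀ (N : ℕ) (A B : RatZ[X]), opOf₂ A B ∈ shiftOps l k →
      (∀ m, N ≤ m → A.coeff m = 0) → (∀ m, N ≤ m → B.coeff m = 0) →
      ∃ q : ℂ[X], opOf₂ A B = G * Polynomial.aeval (cherednik k) q by
    obtain ⟨A, B, rfl⟩ := exists_opOf₂_eq hS.1
    exact h (A.natDegree + B.natDegree + 1) A B hS
      (fun m hm => Polynomial.coeff_eq_zero_of_natDegree_lt (by omega))
      (fun m hm => Polynomial.coeff_eq_zero_of_natDegree_lt (by omega))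
  intro N
  induction N with
  | zero =>
    intro A B _ hA hB
    have hA0 : A = 0 := Polynomial.ext fun m => hA m (Nat.zero_le m)
    have hB0 : B = 0 := Polynomial.ext fun m => hB m (Nat.zero_le m)
    exact ⟨0, by rw [hA0, hB0, opOf₂, opOf_zero, zero_mul, add_zero, map_zero, mul_zero]⟩
  | succ N ih =>
    intro A B hAB hA hB
    by_cases h0 : opOf₂ A B = 0
    · exact ⟨0, by rw [h0, map_zero, mul_zero]⟩
    have hMN : M ≤ N := hmin A B N hAB h0 hA hB
    have hT : G * cherednik k ^ (N - M) ∈ shiftOps l k :=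
      mul_mem_shiftOps_right hG (pow_mem (cherednik_mem_shiftAlg k) _)
    have hTp : IsFirstOrderProduct N (G * cherednik k ^ (N - M)) := by
      rw [mul_cherednik_pow hG]
      convert ((isFirstOrderProduct_cherednik _).pow (N - M)).comp hGM using 1
      omega
    obtain ⟨p, hp, A', B', hAB', hA', hB', rfl⟩ := hTp.hasSymbol
    obtain ⟨hBN, hAN⟩ := symbol_of_intertwine hAB.2.1 (N := N) hA hB
    obtain ⟨-, hAN'⟩ := symbol_of_intertwine (A := A') (B := B') (hAB' ▸ hT.2.1) (N := N) hA'
      fun m hm => hB' m hm.le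
    obtain ⟨c, hc⟩ := exists_eq_C_mul_of_euler hAN hAN' hp
    have hsub : opOf₂ (A + Polynomial.C (algebraMap ℂ RatZ (-c)) * A')
        (B + Polynomial.C (algebraMap ℂ RatZ (-c)) * B')
        = opOf₂ A B - c • (G * cherednik k ^ (N - M)) := by
      rw [opOf₂_add, opOf₂_C_mul, ← hAB', sub_eq_add_neg, ← neg_smul]
      congr 1
      ext f
      exact (Algebra.smul_def _ _).symm
    have hcA : ∀ m, N ≤ m →
        (A + Polynomial.C (algebraMap ℂ RatZ (-c)) * A').coeff m = 0 := by
      intro m hm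
      rw [Polynomial.coeff_add, Polynomial.coeff_C_mul]
      rcases hm.eq_or_lt with rfl | hm
      · rw [hc, map_neg]
        ring
      · rw [hA m hm, hA' m hm, mul_zero, add_zero]
    have hcB : ∀ m, N ≤ m →
        (B + Polynomial.C (algebraMap ℂ RatZ (-c)) * B').coeff m = 0 := by
      intro m hm
      rw [Polynomial.coeff_add, Polynomial.coeff_C_mul, hB' m hm, mul_zero, add_zero]
      rcases hm.eq_or_lt with rfl | hm
      · exact hBN
      · exact hB m hm
    obtain ⟨q, hq⟩ := ih _ _ (hsub ▸ sub_mem hAB (Submodule.smul_mem _ c hT)) hcA hcB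
    refine ⟨q + Polynomial.C c * Polynomial.X ^ (N - M), ?_⟩
    rw [hsub, sub_eq_iff_eq_add] at hq
    rw [hq, map_add, mul_add, map_mul, map_pow, Polynomial.aeval_X, Polynomial.aeval_C,
      ← Algebra.smul_def, mul_smul_comm]

theorem shiftAlg_eq_adjoin (k : ℂ × ℂ) : shiftAlg k = Algebra.adjoin ℂ {cherednik k} := by
  refine le_antisymm (fun S hS => ?_)
    (Algebra.adjoin_le (Set.singleton_subset_iff.2 (cherednik_mem_shiftAlg k)))
  obtain ⟨q, rfl⟩ := exists_eq_mul_aeval (l := 0) (shiftAlg k).one_mem .one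
    (fun _ _ _ _ _ _ _ => Nat.zero_le _) hS
  rw [one_mul]
  exact Polynomial.aeval_mem_adjoin_singleton ℂ _

theorem exists_basis_gen {l : ℤ × ℤ} (hl : Even l.1) {k : ℂ × ℂ}
    (h1 : l.1 + l.2 < 0 → ∀ n : ℕ, k.1 + k.2 ≠ (n : ℂ) + 1 / 2)
    (h2 : l.2 < 0 → ∀ n : ℕ, k.2 ≠ (n : ℂ) + 1 / 2) :
    ∃ b : Module.Basis Unit (shiftAlg k)ᵐᵒᵖ (shiftOps l k), (b () : Op) = gen l k := by
  let g : shiftOps l k := ⟨gen l k, gen_mem_shiftOps hl k⟩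
  have hG := isFirstOrderProduct_gen hl k
  have hinj : Function.Injective (LinearMap.toSpanSingleton (shiftAlg k)ᵐᵒᵖ (shiftOps l k) g) := by
    rw [injective_iff_map_eq_zero]
    intro Q hQ
    have h : gen l k * (Q.unop : Op) = 0 := congrArg Subtype.val hQ
    exact MulOpposite.unop_injective (Subtype.ext (hG.eq_zero_of_mul_eq_zero Q.unop.2.1 h))
  have hsurj : Function.Surjective
      (LinearMap.toSpanSingleton (shiftAlg k)ᵐᵒᵖ (shiftOps l k) g) := by
    intro S
    obtain ⟨q, hq⟩ := exists_eq_mul_aeval g.2 hG (fun A B N hS hS0 hA hB => by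
      obtain ⟨h, h'⟩ := order_lower_bound h1 h2 hS hS0 hA hB
      exact max_le h h') S.2
    exact ⟨MulOpposite.op ⟨_, aeval_cherednik_mem_shiftAlg k q⟩, Subtype.ext hq.symm⟩
  refine ⟨(Module.Basis.singleton Unit (shiftAlg k)ᵐᵒᵖ).map
    (LinearEquiv.ofBijective _ ⟨hinj, hsurj⟩), ?_⟩
  rw [Module.Basis.map_apply, Module.Basis.singleton_apply]
  exact congrArg Subtype.val (one_smul (shiftAlg k)ᵐᵒᵖ g)

end BCOne

end

theorem mainTheorem1 (k : ℂ × ℂ) :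
    -- (i) the algebra of shift operators with shift zero is generated by the Cherednik operator
    BCOne.shiftAlg k = Algebra.adjoin ℂ {BCOne.cherednik k} ∧
    -- (ii) the shift operators with shift `l` form a free right module with basis `gen l k`
    (∀ l : ℤ × ℤ, Even l.1 →
      BCOne.gen l k ∈ BCOne.shiftOps l k ∧
      ((l.1 + l.2 < 0 → ∀ n : ℕ, k.1 + k.2 ≠ (n : ℂ) + 1 / 2) →
        (l.2 < 0 → ∀ n : ℕ, k.2 ≠ (n : ℂ) + 1 / 2) →
        ∃ b : Module.Basis Unit (BCOne.shiftAlg k)ᵐᵒᵖ (BCOne.shiftOps l k),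
          (b () : BCOne.Op) = BCOne.gen l k)) ∧
    -- (iii) the composition relations
    (∀ l l' : ℤ × ℤ, Even l.1 → Even l'.1 →
      l.1.sign = l'.1.sign → (l.1 / 2 + l.2).sign = (l'.1 / 2 + l'.2).sign →
      BCOne.gen (l + l') k = BCOne.gen l' (BCOne.shift k l) * BCOne.gen l k ∧
      BCOne.gen (l + l') k = BCOne.gen l (BCOne.shift k l') * BCOne.gen l' k) := by
  refine ⟨BCOne.shiftAlg_eq_adjoin k, fun l hl => ⟨BCOne.gen_mem_shiftOps hl k,
    BCOne.exists_basis_gen hl⟩, fun l l' hl hl' h1 h2 => ⟨BCOne.gen_add hl hl' h1 h2 k, ?_⟩⟩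
  rw [add_comm]
  exact BCOne.gen_add hl' hl h1.symm h2.symm k
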